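/- For a sequence $\alpha=(\alpha_2,\alpha_3,\dots)$ of non-negative integers with finitely many nonzero terms put $|\alpha|=\sum_{j\ge2}\alpha_j$ and $\langle\alpha\rangle=\sum_{j\ge2}(j-1)\alpha_j$. A minimal factorization of type $\alpha$ is an expression $(1\,2\,\ldots\,n)=\sigma_m\cdots\sigma_1$ in the symmetric group $S_n$, where $n=\langle\alpha\rangle+1$ and the $\sigma_i$ are cycles, exactly $\alpha_j$ of them of length $j$ for each $j\ge2$ (for $\alpha=0$ this is the empty factorization of the identity of $S_1$; the factorization with a single factor $\sigma_1=(1\,2\,\ldots\,n)$ is allowed). Two factorizations are equivalent if one is obtained from the other by repeatedly exchanging neighbouring commuting factors. Let $\widetilde H(\alpha)$ be the number of equivalence classes of minimal factorizations of type $\alpha$, and let $$\xi(x)=\sum_{\alpha}\widetilde H(\alpha)\,x_2^{\alpha_2}x_3^{\alpha_3}\cdots\in\mathbb Z[[x_2,x_3,\dots]],$$ the sum being over all $\alpha$. Then, as formal power series, $$\xi=1+\sum_{j\ge2}x_j\,\xi^{2j-1}=1+x_2\xi^3+x_3\xi^5+\cdots .$$ Moreover, for every integer $n\ge0$, $$\sum_{\alpha:\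 \langle\alpha\rangle=n}(-1)^{|\alpha|+n}\,\widetilde H(\alpha)=\frac1{n+1}\binom{2n}{n}=c_n,$$ a finite sum, where $c_n$ is the $n$-th Catalan number. -/

import Mathlib

/-- The possible cycle lengths `j ≥ 2`; they also index the variables `x_2, x_3, …`. -/
abbrev CycleLength : Type := {j : ℕ // 2 ≤ j}

/-- A type `α = (α_2, α_3, …)`, with finitely many nonzero entries. -/
abbrev CycleType : Type := CycleLength →₀ ℕ

namespace CycleType

/-- `|α| = ∑_{j ≥ 2} α_j`. -/
def size (α : CycleType) : ℕ := α.sum fun _ a => a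

/-- `⟨α⟩ = ∑_{j ≥ 2} (j - 1) α_j`. -/
def rank (α : CycleType) : ℕ := α.sum fun j a => ((j : ℕ) - 1) * a

end CycleType

/-- The list `[σ_m, …, σ_1]` is a factorization `σ_m ⋯ σ_1` of the cycle `(1 2 … n)` (here the
rotation `i ↦ i + 1` of `Fin n`) into cycles, with exactly `α_j` factors of length `j`. -/
structure IsFactorization (n : ℕ) (α : CycleType) (l : List (Equiv.Perm (Fin n))) : Prop where
  isCycle : ∀ σ ∈ l, σ.IsCycle
  prod_eq : l.prod = finRotate n
  count_eq : ∀ j : CycleLength, l.countP (fun σ => σ.support.card = (j : ℕ)) = α j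

/-- Minimal factorizations of `(1 2 … n)` of type `α`: those with `⟨α⟩ = n - 1`. -/
def MinimalFactorization (n : ℕ) (α : CycleType) : Type :=
  {l : List (Equiv.Perm (Fin n)) // IsFactorization n α l ∧ α.rank + 1 = n}

/-- Two products differ by the exchange of two neighbouring factors that commute. -/
inductive CommutingSwap {n : ℕ} : List (Equiv.Perm (Fin n)) → List (Equiv.Perm (Fin n)) → Prop
  | swap (l₁ l₂ : List (Equiv.Perm (Fin n))) (σ τ : Equiv.Perm (Fin n)) (h : Commute σ τ) :
      CommutingSwap (l₁ ++ σ :: τ :: l₂) (l₁ ++ τ :: σ :: l₂)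

/-- Equivalence of minimal factorizations: one arises from the other by a sequence of exchanges
of neighbouring commuting factors. -/
def factorizationSetoid (n : ℕ) (α : CycleType) : Setoid (MinimalFactorization n α) :=
  (Relation.EqvGen.setoid (CommutingSwap (n := n))).comap Subtype.val

/-- The number of inequivalent minimal factorizations of type `α`; minimality forces
`n = ⟨α⟩ + 1`. -/
noncomputable def Htilde (α : CycleType) : ℕ :=
  Nat.card (Quotient (factorizationSetoid (α.rank + 1) α))

/-- The generating function `ξ(x) = ∑_α H̃(α) x_2^{α_2} x_3^{α_3} ⋯`, as a formal power series:
its coefficient at `x^α` is `H̃(α)`. -/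
noncomputable def xi : MvPowerSeries CycleLength ℤ := fun α => (Htilde α : ℤ)

/-!
In a minimal factorization of an `n`-cycle the supports of the factors form a connected hypergraph
on `n` points, and `n = ⟨α⟩ + 1` is the largest number of vertices that edges of these sizes can
connect. So it is a hypertree: cutting it at a vertex yields two hypertrees that meet in this vertex
only, and factors on different sides of the cut commute unless both move the vertex. Repeated
cutting brings each minimal factorization, by exchanges of commuting neighbours, to a form that is
read off from a rooted plane cactus, whose polygons are the factors and whose boundary is the cyclic
word. The cactus can be recovered from the set of factors, hence `H̃(α)` counts plane cacti.

A plane cactus other than a point has a last polygon at its root, say with `j` vertices. Each of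
its `j - 1` other vertices carries two cacti, one on either side of the polygon, and the remaining
polygons at the root form one more cactus. Summing over `j` gives `ξ - 1 = ∑ x_j ξ^(2j-1)`.

Substituting `-(-t)^(j-1)` for `x_j` turns `ξ` into the series `f` of the signed sums, and the
equation into `f - 1 = t f³ ∑ (-t f²)^k = t f³ / (1 + t f²)`. Clearing the denominator leaves
`f = 1 + t f²`, the equation of the Catalan generating function.
-/

open Equiv

/-- The equivalence of words generated by exchanging neighbouring letters that commute: equality in
the trace monoid (Cartier–Foata). It is set up like `List.Perm`. -/
inductive TraceEquiv {M : Type*} [Mul M] : List M → List M → Prop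
  | nil : TraceEquiv [] []
  | cons (a : M) {l l' : List M} (h : TraceEquiv l l') : TraceEquiv (a :: l) (a :: l')
  | swap {a b : M} (h : Commute a b) (l : List M) : TraceEquiv (a :: b :: l) (b :: a :: l)
  | trans {l l' l'' : List M} (h : TraceEquiv l l') (h' : TraceEquiv l' l'') : TraceEquiv l l''

namespace TraceEquiv

section Mul

variable {M : Type*} [Mul M] {l l' : List M}

@[refl] theorem refl : ∀ l : List M, TraceEquiv l l
  | [] => .nil
  | a :: l => .cons a (refl l)

@[symm] theorem symm (h : TraceEquiv l l') : TraceEquiv l' l := by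
  induction h with
  | nil => exact .nil
  | cons a _ ih => exact .cons a ih
  | swap h l => exact .swap h.symm l
  | trans _ _ ih ih' => exact ih'.trans ih

theorem perm (h : TraceEquiv l l') : l.Perm l' := by
  induction h with
  | nil => exact .nil
  | cons a _ ih => exact ih.cons a
  | swap _ l => exact .swap _ _ l
  | trans _ _ ih ih' => exact ih.trans ih'

theorem append_left (k : List M) (h : TraceEquiv l l') : TraceEquiv (k ++ l) (k ++ l') := by
  induction k with
  | nil => exact h
  | cons a _ ih => exact .cons a ih

theorem append_right (k : List M) (h : TraceEquiv l l') : TraceEquiv (l ++ k) (l' ++ k) := by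
  induction h with
  | nil => rfl
  | cons a _ ih => exact .cons a ih
  | swap h l => exact .swap h (l ++ k)
  | trans _ _ ih ih' => exact ih.trans ih'

theorem append {k k' : List M} (h : TraceEquiv l l') (hk : TraceEquiv k k') :
    TraceEquiv (l ++ k) (l' ++ k') :=
  (h.append_right k).trans (hk.append_left l')

theorem cons_append_comm {a : M} (h : ∀ b ∈ l, Commute a b) (l' : List M) :
    TraceEquiv (a :: (l ++ l')) (l ++ a :: l') := by
  induction l with
  | nil => rfl
  | cons b l ih =>
    rw [List.forall_mem_cons] at h
    exact (swap h.1 _).trans (.cons b (ih h.2))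

theorem filter_append_filter (p : M → Bool)
    (h : l.Pairwise fun a b => p a = false → p b = true → Commute a b) :
    TraceEquiv l (l.filter p ++ l.filter fun a => !p a) := by
  induction l with
  | nil => rfl
  | cons a l ih =>
    obtain ⟨ha, hl⟩ := List.pairwise_cons.1 h
    refine (TraceEquiv.cons a (ih hl)).trans ?_
    by_cases hp : p a = true
    · simp only [hp, List.filter_cons_of_pos, Bool.not_true, Bool.false_eq_true, not_false_eq_true,
        List.filter_cons_of_neg, List.cons_append]
      rfl
    · have hp : p a = false := by simpa using hp
      simpa [hp] using cons_append_comm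
        (fun b hb => ha b (List.mem_of_mem_filter hb) hp (List.of_mem_filter hb)) _

end Mul

theorem prod_eq {M : Type*} [Monoid M] {l l' : List M} (h : TraceEquiv l l') :
    l.prod = l'.prod := by
  induction h with
  | nil => rfl
  | cons a _ ih => simp [ih]
  | swap h l => simp [← mul_assoc, h.eq]
  | trans _ _ ih ih' => exact ih.trans ih'

theorem eqvGen_commutingSwap_cons {n : ℕ} (σ : Perm (Fin n)) {l l' : List (Perm (Fin n))}
    (h : Relation.EqvGen CommutingSwap l l') :
    Relation.EqvGen CommutingSwap (σ :: l) (σ :: l') := by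
  induction h with
  | rel _ _ h =>
    obtain ⟨l₁, l₂, τ, ρ, h⟩ := h
    exact .rel _ _ (.swap (σ :: l₁) l₂ τ ρ h)
  | refl l => exact .refl _
  | symm _ _ _ ih => exact ih.symm
  | trans _ _ _ _ _ ih ih' => exact ih.trans _ _ _ ih'

theorem eqvGen_commutingSwap_iff {n : ℕ} {l l' : List (Perm (Fin n))} :
    Relation.EqvGen CommutingSwap l l' ↔ TraceEquiv l l' := by
  constructor <;> intro h
  · induction h with
    | rel _ _ h =>
      obtain ⟨l₁, l₂, σ, τ, h⟩ := h
      exact (swap h l₂).append_left l₁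
    | refl l => rfl
    | symm _ _ _ ih => exact ih.symm
    | trans _ _ _ _ _ ih ih' => exact ih.trans ih'
  · induction h with
    | nil => exact .refl _
    | cons σ _ ih => exact eqvGen_commutingSwap_cons σ ih
    | swap h l => exact .rel _ _ (.swap [] l _ _ h)
    | trans _ _ ih ih' => exact ih.trans _ _ _ ih'

end TraceEquiv

section FormPerm

open List

variable {X : Type*} [DecidableEq X] {r x v : X} {a b u w : List X}

theorem formPerm_append_comm (h : (u ++ w).Nodup) : formPerm (u ++ w) = formPerm (w ++ u) :=
  formPerm_eq_of_isRotated h isRotated_append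

theorem formPerm_append_cons (u w : List X) (x : X) :
    formPerm (u ++ x :: w) = formPerm (u ++ [x]) * formPerm (x :: w) := by
  induction u with
  | nil => simp
  | cons y u ih =>
    cases u with
    | nil => simp
    | cons z u =>
      simp only [cons_append, formPerm_cons_cons] at ih ⊢
      rw [ih, mul_assoc]

theorem formPerm_mul_formPerm (h : (x :: w ++ u).Nodup) :
    formPerm (x :: u) * formPerm (x :: w) = formPerm (x :: w ++ u) := by
  have hu : ([x] ++ u).Nodup := h.sublist (by simp)
  rw [formPerm_append_comm h, formPerm_append_cons, ← formPerm_append_comm hu]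
  simp

theorem formPerm_insert (h : (r :: (a ++ v :: (b ++ w))).Nodup) :
    formPerm (v :: a) * (formPerm (r :: w) * formPerm [r, v]) * formPerm (v :: b) =
      formPerm (r :: (a ++ v :: (b ++ w))) := by
  have hv : (v :: (b ++ (w ++ [r])) ++ a).Nodup := by
    simpa using nodup_append_comm.1 (show (r :: a ++ v :: (b ++ w)).Nodup from h)
  have hw : (v :: b ++ (w ++ [r])).Nodup := hv.sublist (by simp)
  have hr : (r :: [v] ++ w).Nodup :=
    (nodup_append_comm (l₁ := v :: w) (l₂ := [r])).1 (hw.sublist (by simp))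
  have hrot : formPerm (r :: [v] ++ w) = formPerm (v :: (w ++ [r])) :=
    formPerm_append_comm (u := [r]) (w := v :: w) hr
  calc formPerm (v :: a) * (formPerm (r :: w) * formPerm [r, v]) * formPerm (v :: b)
      = formPerm (v :: a) * (formPerm (v :: (w ++ [r])) * formPerm (v :: b)) := by
        rw [formPerm_mul_formPerm hr, hrot, mul_assoc]
    _ = formPerm (v :: a) * formPerm (v :: (b ++ (w ++ [r]))) := by
        rw [formPerm_mul_formPerm hw, cons_append]
    _ = formPerm (v :: (b ++ w) ++ r :: a) := by
        rw [formPerm_mul_formPerm hv]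
        simp
    _ = formPerm (r :: (a ++ v :: (b ++ w))) :=
        (formPerm_append_comm (u := r :: a) h).symm

theorem subset_of_formPerm_mem {S : Finset X} (h : (r :: u).Nodup) (hr : r ∈ S)
    (hS : ∀ x ∈ S, formPerm (r :: u) x ∈ S) : (r :: u).toFinset ⊆ S := by
  intro y hy
  obtain ⟨i, hi, rfl⟩ := getElem_of_mem (mem_toFinset.1 hy)
  have hpow (k : ℕ) : (formPerm (r :: u) ^ k) r ∈ S := by
    induction k with
    | zero => simpa
    | succ k ih => rw [pow_succ']; exact hS _ ih
  simpa [formPerm_pow_apply_head _ _ h, Nat.mod_eq_of_lt (show i < u.length + 1 from hi)]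
    using hpow i

theorem support_formPerm_cons [Fintype X] (h : (r :: u).Nodup) (hu : u ≠ []) :
    (formPerm (r :: u)).support = (r :: u).toFinset :=
  support_formPerm_of_nodup _ h (by simpa using hu)

theorem eq_of_formPerm_cons_eq (hu : (r :: u).Nodup) (hw : (r :: w).Nodup)
    (h : formPerm (r :: u) = formPerm (r :: w)) : u = w := by
  rcases (formPerm_eq_formPerm_iff hu hw).1 h with hrot | hlen
  · refine (List.cons.inj (ext_getElem hrot.perm.length_eq fun i hi hi' => ?_)).2
    have := congrArg (fun σ => (σ ^ i) r) h
    simpa [formPerm_pow_apply_head _ _ hu, formPerm_pow_apply_head _ _ hw,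
      Nat.mod_eq_of_lt (show i < u.length + 1 from hi),
      Nat.mod_eq_of_lt (show i < w.length + 1 from hi')] using this
  · rw [length_eq_zero_iff.1 (Nat.le_zero.1 (Nat.le_of_succ_le_succ hlen.1)),
      length_eq_zero_iff.1 (Nat.le_zero.1 (Nat.le_of_succ_le_succ hlen.2))]

end FormPerm

section Hypergraph

variable {X : Type*} [DecidableEq X] [Fintype X] {l l' l₁ l₂ : List (Perm X)} {S V : Finset X}
  {v x : X}

/-- `S` is a union of connected components of the hypergraph whose edges are the supports of the
permutations in `l`. -/
def SupportClosed (l : List (Perm X)) (S : Finset X) : Prop :=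
  ∀ σ ∈ l, Disjoint σ.support S ∨ σ.support ⊆ S

theorem SupportClosed.mono (h : SupportClosed l S) (hl : l' ⊆ l) : SupportClosed l' S :=
  fun σ hσ => h σ (hl hσ)

theorem SupportClosed.compl (h : SupportClosed l S) : SupportClosed l Sᶜ := fun σ hσ =>
  (h σ hσ).symm.imp (fun h => disjoint_compl_right.mono_left h)
    fun h => Finset.subset_compl_iff_disjoint_right.2 h

theorem SupportClosed.prod_apply_mem (h : SupportClosed l S) (hx : x ∈ S) : l.prod x ∈ S := by
  induction l with
  | nil => simpa
  | cons σ l ih =>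
    have hy := ih (h.mono (by simp))
    rw [List.prod_cons, Perm.mul_apply]
    by_cases hs : l.prod x ∈ σ.support
    · rcases h σ (by simp) with h | h
      · exact absurd hy (Finset.disjoint_left.1 h hs)
      · exact h (Perm.apply_mem_support.2 hs)
    · rwa [Perm.notMem_support.1 hs]

/-- The sum of the ranks `|σ| - 1` of the factors, where `|σ|` counts the points moved by `σ`. -/
def totalRank (l : List (Perm X)) : ℕ := (l.map fun σ => σ.support.card - 1).sum

@[simp] theorem totalRank_nil : totalRank ([] : List (Perm X)) = 0 := rfl

@[simp] theorem totalRank_cons (σ : Perm X) (l : List (Perm X)) :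
    totalRank (σ :: l) = (σ.support.card - 1) + totalRank l := by
  simp [totalRank]

theorem totalRank_append (l l' : List (Perm X)) :
    totalRank (l ++ l') = totalRank l + totalRank l' := by
  simp [totalRank]

theorem totalRank_perm (h : l.Perm l') : totalRank l = totalRank l' :=
  (h.map _).sum_eq

theorem exists_supportClosed_superset (l : List (Perm X)) (S : Finset X) :
    ∃ T, SupportClosed l T ∧ S ⊆ T ∧ T.card ≤ S.card + totalRank l := by
  induction hl : l.length generalizing l S with
  | zero =>
    obtain rfl := List.length_eq_zero_iff.1 hl
    exact ⟨S, by simp [SupportClosed], subset_rfl, by simp⟩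
  | succ m ih =>
    by_cases h : ∀ σ ∈ l, Disjoint σ.support S
    · exact ⟨S, fun σ hσ => .inl (h σ hσ), subset_rfl, by simp⟩
    push Not at h
    obtain ⟨σ, hσ, hS⟩ := h
    have hp := List.perm_cons_erase hσ
    obtain ⟨T, hT, hST, hc⟩ := ih (l.erase σ) (S ∪ σ.support)
      (by rw [List.length_erase_of_mem hσ, hl]; rfl)
    refine ⟨T, fun τ hτ => ?_, Finset.subset_union_left.trans hST, ?_⟩
    · rcases List.mem_cons.1 (hp.subset hτ) with rfl | hτ
      · exact .inr (Finset.subset_union_right.trans hST)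
      · exact hT τ hτ
    · have hcard := Finset.card_union_add_card_inter S σ.support
      have hpos : 0 < (S ∩ σ.support).card :=
        Finset.card_pos.2 (Finset.not_disjoint_iff_nonempty_inter.1 fun h => hS h.symm)
      have hle : (S ∩ σ.support).card ≤ σ.support.card :=
        Finset.card_le_card Finset.inter_subset_right
      rw [totalRank_perm hp, totalRank_cons]
      omega

open Classical in
/-- The connected component of `v` in the hypergraph whose edges are the supports of the
permutations in `l`. -/
noncomputable def supportComponent (l : List (Perm X)) (v : X) : Finset X :=
  {x | ∀ S, SupportClosed l S → v ∈ S → x ∈ S}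

theorem mem_supportComponent :
    x ∈ supportComponent l v ↔ ∀ S, SupportClosed l S → v ∈ S → x ∈ S := by
  simp [supportComponent]

theorem self_mem_supportComponent (l : List (Perm X)) (v : X) : v ∈ supportComponent l v :=
  mem_supportComponent.2 fun _ _ h => h

theorem supportComponent_subset (hS : SupportClosed l S) (hv : v ∈ S) :
    supportComponent l v ⊆ S :=
  fun _ hx => mem_supportComponent.1 hx S hS hv

theorem supportComponent_mono (h : l ⊆ l') : supportComponent l v ⊆ supportComponent l' v :=
  fun _ hx => mem_supportComponent.2 fun S hS => mem_supportComponent.1 hx S (hS.mono h)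

theorem supportComponent_perm (h : l.Perm l') : supportComponent l v = supportComponent l' v :=
  (supportComponent_mono h.subset).antisymm (supportComponent_mono h.symm.subset)

theorem supportClosed_supportComponent (l : List (Perm X)) (v : X) :
    SupportClosed l (supportComponent l v) := by
  intro σ hσ
  refine or_iff_not_imp_left.2 fun h y hy => mem_supportComponent.2 fun S hS hv => ?_
  obtain ⟨x, hx, hxc⟩ := Finset.not_disjoint_iff.1 h
  rcases hS σ hσ with hd | hd
  · exact absurd (supportComponent_subset hS hv hxc) (Finset.disjoint_left.1 hd hx)
  · exact hd hy

theorem card_supportComponent_le (l : List (Perm X)) (v : X) :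
    (supportComponent l v).card ≤ totalRank l + 1 := by
  obtain ⟨T, hT, hvT, hc⟩ := exists_supportClosed_superset l {v}
  rw [Finset.card_singleton, add_comm] at hc
  exact (Finset.card_le_card (supportComponent_subset hT (by simpa using hvT))).trans hc

theorem exists_filter_supportComponent (l : List (Perm X)) (v : X) (P : Perm X → Bool) :
    ∃ p : Perm X → Bool, (∀ σ ∈ l, v ∈ σ.support → p σ = P σ) ∧
      (∀ σ ∈ l, p σ = true → σ.support ⊆ supportComponent (l.filter p) v) ∧
      ∀ σ ∈ l, p σ = false →
        v ∈ σ.support ∨ Disjoint σ.support (supportComponent (l.filter p) v) := by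
  set keep : Perm X → Bool := fun σ => decide (v ∈ σ.support → P σ = true) with hkeep
  set C := supportComponent (l.filter keep) v
  have hvC : v ∈ C := self_mem_supportComponent _ v
  have hC : ∀ σ ∈ l, keep σ = true → Disjoint σ.support C ∨ σ.support ⊆ C := fun σ hσ hk =>
    supportClosed_supportComponent _ v σ (List.mem_filter.2 ⟨hσ, hk⟩)
  set p : Perm X → Bool := fun σ => keep σ && decide (σ.support ⊆ C) with hp
  have hp_iff (σ : Perm X) : p σ = true ↔ keep σ = true ∧ σ.support ⊆ C := by simp [hp]
  have hpC : supportComponent (l.filter p) v = C := by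
    refine (supportComponent_subset (fun σ hσ => .inr ?_) hvC).antisymm
      (supportComponent_subset (fun σ hσ => ?_) (self_mem_supportComponent _ v))
    · exact ((hp_iff σ).1 (List.of_mem_filter hσ)).2
    · obtain ⟨hσ, hk⟩ := List.mem_filter.1 hσ
      rcases hC σ hσ hk with hd | hs
      · exact .inl (hd.mono_right (supportComponent_subset
          (fun τ hτ => .inr ((hp_iff τ).1 (List.of_mem_filter hτ)).2) hvC))
      · exact supportClosed_supportComponent _ v σ
          (List.mem_filter.2 ⟨hσ, (hp_iff σ).2 ⟨hk, hs⟩⟩)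
  refine ⟨p, fun σ hσ hvσ => ?_, fun σ _ hpσ => hpC ▸ ((hp_iff σ).1 hpσ).2, fun σ hσ hpσ => ?_⟩
  · have hkσ : keep σ = P σ := by
      simp only [hkeep, hvσ, forall_const, Bool.decide_eq_true]
    rw [Bool.eq_iff_iff, hp_iff, hkσ, and_iff_left_iff_imp, ← hkσ]
    exact fun hk => (hC σ hσ hk).resolve_left fun hd => Finset.disjoint_left.1 hd hvσ hvC
  · rw [hpC]
    by_cases hk : keep σ = true
    · refine .inr ((hC σ hσ hk).resolve_right fun hs => ?_)
      simp [(hp_iff σ).2 ⟨hk, hs⟩] at hpσ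
    · exact .inl (by simp_all)

theorem supportComponent_append_eq (hl : ∀ σ ∈ l, σ.support ⊆ S)
    (hl' : ∀ σ ∈ l', Disjoint σ.support S) (hv : v ∈ S) (hS : S ⊆ supportComponent l v) :
    supportComponent (l ++ l') v = S := by
  refine (supportComponent_subset (fun σ hσ => ?_) hv).antisymm
    (hS.trans (supportComponent_mono (List.subset_append_left l l')))
  exact (List.mem_append.1 hσ).symm.imp (hl' σ) (hl σ)

/-- The supports of the cycles in `l` are the edges of a hypertree with vertex set `V`: a connected
hypergraph whose number of vertices is the largest possible for its edge sizes. -/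
structure IsHypertree (l : List (Perm X)) (V : Finset X) : Prop where
  isCycle : ∀ σ ∈ l, σ.IsCycle
  support_subset : ∀ σ ∈ l, σ.support ⊆ V
  connected : ∀ v ∈ V, V ⊆ supportComponent l v
  card_eq : V.card = totalRank l + 1

namespace IsHypertree

theorem of_root (hcycle : ∀ σ ∈ l, σ.IsCycle) (hsupp : ∀ σ ∈ l, σ.support ⊆ V) {r : X}
    (hconn : V ⊆ supportComponent l r) (hcard : V.card = totalRank l + 1) : IsHypertree l V where
  isCycle := hcycle
  support_subset := hsupp
  connected v hv x hx := mem_supportComponent.2 fun S hS hvS => by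
    by_cases hr : r ∈ S
    · exact supportComponent_subset hS hr (hconn hx)
    · exact absurd hvS (Finset.mem_compl.1
        (supportComponent_subset hS.compl (Finset.mem_compl.2 hr) (hconn hv)))
  card_eq := hcard

theorem perm (h : IsHypertree l V) (hl : l.Perm l') : IsHypertree l' V where
  isCycle σ hσ := h.isCycle σ (hl.mem_iff.2 hσ)
  support_subset σ hσ := h.support_subset σ (hl.mem_iff.2 hσ)
  connected v hv := (h.connected v hv).trans (supportComponent_mono hl.subset)
  card_eq := totalRank_perm hl ▸ h.card_eq

theorem nodup (h : IsHypertree l V) : l.Nodup := by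
  by_contra hl
  obtain ⟨σ, hσ⟩ := List.exists_duplicate_iff_not_nodup.2 hl
  obtain ⟨v, hv⟩ : V.Nonempty := Finset.card_pos.1 (by rw [h.card_eq]; omega)
  have hperm := List.perm_cons_erase hσ.mem
  have hσ' : σ ∈ l.erase σ := by
    rw [← List.count_pos_iff, List.count_erase_self]
    have := List.duplicate_iff_two_le_count.1 hσ
    omega
  have hsub : l ⊆ l.erase σ :=
    List.Subset.trans hperm.subset (List.cons_subset.2 ⟨hσ', List.Subset.refl _⟩)
  have hle := (Finset.card_le_card ((h.connected v hv).trans (supportComponent_mono hsub))).trans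
    (card_supportComponent_le _ v)
  have hrank := totalRank_perm hperm
  have htwo := (h.isCycle σ hσ.mem).two_le_card_support
  rw [totalRank_cons] at hrank
  have := h.card_eq
  omega

/-- Each of the two pieces has at most `totalRank + 1` vertices, and they share `v`; as the whole
has `totalRank + 1` vertices, all these bounds are attained. -/
theorem wedge (h : IsHypertree (l₁ ++ l₂) V) (hv : v ∈ V)
    (h₁ : ∀ σ ∈ l₁, σ.support ⊆ supportComponent l₁ v)
    (h₂ : ∀ σ ∈ l₂, σ.support ⊆ supportComponent l₂ v) :
    IsHypertree l₁ (supportComponent l₁ v) ∧ IsHypertree l₂ (supportComponent l₂ v) ∧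
      supportComponent l₁ v ∪ supportComponent l₂ v = V ∧
      supportComponent l₁ v ∩ supportComponent l₂ v = {v} := by
  have hsub : l₁ ⊆ l₁ ++ l₂ ∧ l₂ ⊆ l₁ ++ l₂ := by simp
  have hV : SupportClosed (l₁ ++ l₂) V := fun σ hσ => .inr (h.support_subset σ hσ)
  have hunion : supportComponent l₁ v ∪ supportComponent l₂ v = V := by
    refine (Finset.union_subset (supportComponent_subset (hV.mono hsub.1) hv)
      (supportComponent_subset (hV.mono hsub.2) hv)).antisymm ?_
    refine (h.connected v hv).trans (supportComponent_subset (fun σ hσ => .inr ?_)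
      (Finset.mem_union_left _ (self_mem_supportComponent l₁ v)))
    rcases List.mem_append.1 hσ with hσ | hσ
    · exact (h₁ σ hσ).trans Finset.subset_union_left
    · exact (h₂ σ hσ).trans Finset.subset_union_right
  have hmem : v ∈ supportComponent l₁ v ∩ supportComponent l₂ v :=
    Finset.mem_inter.2 ⟨self_mem_supportComponent _ _, self_mem_supportComponent _ _⟩
  have hpos := Finset.card_pos.2 ⟨v, hmem⟩
  have hcard := Finset.card_union_add_card_inter (supportComponent l₁ v) (supportComponent l₂ v)
  have hle₁ := card_supportComponent_le l₁ v
  have hle₂ := card_supportComponent_le l₂ v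
  rw [hunion, h.card_eq, totalRank_append] at hcard
  refine ⟨of_root (fun σ hσ => h.isCycle σ (hsub.1 hσ)) h₁ subset_rfl (by omega),
    of_root (fun σ hσ => h.isCycle σ (hsub.2 hσ)) h₂ subset_rfl (by omega), hunion, ?_⟩
  refine (Finset.eq_of_subset_of_card_le (Finset.singleton_subset_iff.2 hmem) ?_).symm
  rw [Finset.card_singleton]
  omega

theorem support_subset_supportComponent (h : IsHypertree (l₁ ++ l₂) V) (hv : v ∈ V)
    (h₁ : ∀ σ ∈ l₁, σ.support ⊆ supportComponent l₁ v)
    (h₂ : ∀ σ ∈ l₂, v ∈ σ.support ∨ Disjoint σ.support (supportComponent l₁ v)) :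
    ∀ σ ∈ l₂, σ.support ⊆ supportComponent l₂ v := by
  have hdisj : ∀ σ ∈ l₂, ¬ σ.support ⊆ supportComponent l₂ v →
      Disjoint σ.support (supportComponent l₁ v ∪ supportComponent l₂ v) := fun σ hσ hns => by
    have hd := (supportClosed_supportComponent l₂ v σ hσ).resolve_right hns
    refine Finset.disjoint_union_right.2 ⟨(h₂ σ hσ).resolve_left fun hvσ => ?_, hd⟩
    exact Finset.disjoint_left.1 hd hvσ (self_mem_supportComponent l₂ v)
  have hclosed : SupportClosed (l₁ ++ l₂) (supportComponent l₁ v ∪ supportComponent l₂ v) := by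
    intro σ hσ
    rcases List.mem_append.1 hσ with hσ | hσ
    · exact .inr ((h₁ σ hσ).trans Finset.subset_union_left)
    · by_cases hs : σ.support ⊆ supportComponent l₂ v
      · exact .inr (hs.trans Finset.subset_union_right)
      · exact .inl (hdisj σ hσ hs)
  have hV : V ⊆ supportComponent l₁ v ∪ supportComponent l₂ v := (h.connected v hv).trans
    (supportComponent_subset hclosed (Finset.mem_union_left _ (self_mem_supportComponent l₁ v)))
  intro σ hσ
  by_contra hs
  have hself := (hdisj σ hσ hs).mono_right ((h.support_subset σ (by simp [hσ])).trans hV)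
  exact hs (by simp [disjoint_self.1 hself])

theorem exists_filter (h : IsHypertree l V) (hv : v ∈ V) (P : Perm X → Bool) :
    ∃ (p : Perm X → Bool) (V₁ V₂ : Finset X), IsHypertree (l.filter p) V₁ ∧
      IsHypertree (l.filter fun σ => !p σ) V₂ ∧ V₁ ∪ V₂ = V ∧ V₁ ∩ V₂ = {v} ∧
      ∀ σ ∈ l, v ∈ σ.support → p σ = P σ := by
  obtain ⟨p, hp, hsub, hdisj⟩ := exists_filter_supportComponent l v P
  have h' : IsHypertree (l.filter p ++ l.filter fun σ => !p σ) V :=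
    h.perm (List.filter_append_perm p l).symm
  have h₁ : ∀ σ ∈ l.filter p, σ.support ⊆ supportComponent (l.filter p) v := fun σ hσ =>
    hsub σ (List.mem_of_mem_filter hσ) (List.of_mem_filter hσ)
  have h₂ := h'.support_subset_supportComponent hv h₁ fun σ hσ =>
    hdisj σ (List.mem_of_mem_filter hσ) (by simpa using List.of_mem_filter hσ)
  obtain ⟨ht₁, ht₂, hunion, hinter⟩ := h'.wedge hv h₁ h₂
  exact ⟨p, _, _, ht₁, ht₂, hunion, hinter, hp⟩

theorem exists_traceEquiv_filter {A B : List (Perm X)} (h : IsHypertree (A ++ B) V) (hv : v ∈ V) :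
    ∃ (p : Perm X → Bool) (V₁ V₂ : Finset X), IsHypertree ((A ++ B).filter p) V₁ ∧
      IsHypertree ((A ++ B).filter fun σ => !p σ) V₂ ∧ V₁.val + V₂.val = v ::ₘ V.val ∧
      TraceEquiv (A ++ B) ((A ++ B).filter p ++ (A ++ B).filter fun σ => !p σ) ∧
      (∀ σ ∈ A, v ∈ σ.support → p σ = true) ∧ ∀ σ ∈ B, v ∈ σ.support → p σ = false := by
  obtain ⟨p, V₁, V₂, h₁, h₂, hunion, hinter, hp⟩ := h.exists_filter hv fun σ => decide (σ ∈ A)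
  have hA : ∀ σ ∈ A, v ∈ σ.support → p σ = true := fun σ hσ hvσ => by
    simp [hp σ (List.mem_append_left _ hσ) hvσ, hσ]
  have hB : ∀ σ ∈ B, v ∈ σ.support → p σ = false := fun σ hσ hvσ => by
    simpa [hp σ (List.mem_append_right _ hσ) hvσ] using
      fun hσA => (List.nodup_append.1 h.nodup).2.2 σ hσA σ hσ rfl
  refine ⟨p, V₁, V₂, h₁, h₂, ?_, TraceEquiv.filter_append_filter p ?_, hA, hB⟩
  · rw [← Multiset.union_add_inter, ← Finset.union_val, ← Finset.inter_val, hunion, hinter,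
      Finset.singleton_val, add_comm, Multiset.singleton_add]
  have hcomm : ∀ σ ∈ A ++ B, ∀ τ ∈ A ++ B, p σ = false → p τ = true →
      (v ∉ σ.support ∨ v ∉ τ.support) → Commute σ τ := fun σ hσ τ hτ hpσ hpτ hv => by
    refine Perm.Disjoint.commute (Perm.disjoint_iff_disjoint_support.2 ?_)
    refine Finset.disjoint_left.2 fun x hxσ hxτ => ?_
    have hx : x ∈ V₁ ∩ V₂ := Finset.mem_inter.2 ⟨h₁.support_subset τ (by simp_all) hxτ,
      h₂.support_subset σ (by simp_all) hxσ⟩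
    rw [hinter, Finset.mem_singleton] at hx
    subst hx
    tauto
  refine List.pairwise_append.2 ⟨?_, ?_, fun σ hσ τ hτ hpσ hpτ => ?_⟩
  · refine List.pairwise_of_forall_mem_list fun σ hσ τ hτ hpσ hpτ =>
      hcomm σ (by simp [hσ]) τ (by simp [hτ]) hpσ hpτ (.inl fun hvσ => ?_)
    simp [hA σ hσ hvσ] at hpσ
  · refine List.pairwise_of_forall_mem_list fun σ hσ τ hτ hpσ hpτ =>
      hcomm σ (by simp [hσ]) τ (by simp [hτ]) hpσ hpτ (.inr fun hvτ => ?_)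
    simp [hB τ hτ hvτ] at hpτ
  · refine hcomm σ (by simp [hσ]) τ (by simp [hτ]) hpσ hpτ (.inl fun hvσ => ?_)
    simp [hA σ hσ hvσ] at hpσ

end IsHypertree

end Hypergraph

namespace CycleType

@[simp] theorem rank_zero : rank 0 = 0 := by simp [rank]

theorem rank_add (α β : CycleType) : rank (α + β) = rank α + rank β :=
  Finsupp.sum_add_index' (by simp) (by intros; ring)

@[simp] theorem rank_single (j : CycleLength) (a : ℕ) :
    rank (Finsupp.single j a) = ((j : ℕ) - 1) * a := by
  simp [rank]

section OfList

variable {X : Type*} [DecidableEq X] [Fintype X]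

/-- The type of a single cycle, that is, the unit vector at its length; it is `0` for the
identity. -/
noncomputable def ofPerm (σ : Perm X) : CycleType :=
  if h : 2 ≤ σ.support.card then Finsupp.single ⟨_, h⟩ 1 else 0

/-- The type of a list of cycles: it counts the cycles of each length. -/
noncomputable def ofList (l : List (Perm X)) : CycleType := (l.map ofPerm).sum

@[simp] theorem ofList_nil : ofList ([] : List (Perm X)) = 0 := rfl

@[simp] theorem ofList_cons (σ : Perm X) (l : List (Perm X)) :
    ofList (σ :: l) = ofPerm σ + ofList l := by
  simp [ofList]

@[simp] theorem ofList_append (l l' : List (Perm X)) :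
    ofList (l ++ l') = ofList l + ofList l' := by
  simp [ofList]

theorem ofList_perm {l l' : List (Perm X)} (h : l.Perm l') : ofList l = ofList l' :=
  (h.map _).sum_eq

theorem ofPerm_apply (σ : Perm X) (j : CycleLength) :
    ofPerm σ j = if σ.support.card = (j : ℕ) then 1 else 0 := by
  unfold ofPerm
  split_ifs with h₁ h₂ h₂
  · simp [h₂]
  · simp [Subtype.ext_iff, h₂]
  · exact absurd (h₂ ▸ j.2) h₁
  · rfl

theorem ofList_apply (l : List (Perm X)) (j : CycleLength) :
    ofList l j = l.countP fun σ => σ.support.card = (j : ℕ) := by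
  induction l with
  | nil => simp
  | cons σ l ih =>
    rw [ofList_cons, Finsupp.add_apply, ih, ofPerm_apply, List.countP_cons, add_comm]
    simp

theorem rank_ofList (l : List (Perm X)) : (ofList l).rank = totalRank l := by
  induction l with
  | nil => simp
  | cons σ l ih =>
    rw [ofList_cons, rank_add, ih, totalRank_cons, ofPerm]
    split_ifs with h
    · simp
    · simp only [rank_zero, zero_add, Nat.right_eq_add]
      omega

theorem ofPerm_formPerm {r : X} {u : List X} (h : (r :: u).Nodup) (hu : 2 ≤ u.length + 1) :
    ofPerm (List.formPerm (r :: u)) = Finsupp.single ⟨u.length + 1, hu⟩ 1 := by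
  have hcard : (List.formPerm (r :: u)).support.card = u.length + 1 := by
    rw [support_formPerm_cons h (by rintro rfl; simp at hu), List.toFinset_card_of_nodup h,
      List.length_cons]
  rw [ofPerm, dif_pos (by omega)]
  congr

end OfList

end CycleType

mutual
/-- A rooted plane cactus, that is, a tree-like arrangement of polygons in the plane. It is a point,
or it consists of a cactus `t` at the root followed by a last polygon, whose vertices other than the
root carry the chain `c`. -/
inductive PlaneCactus : Type
  | point : PlaneCactus
  | attach {k : ℕ} (c : CactusChain (k + 1)) (t : PlaneCactus) : PlaneCactus
/-- A sequence of `k` vertices on a polygon. The outside of the polygon at such a vertex is cut in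
two by the word that is drawn along the boundary, so that each vertex carries a plane cactus on
either side. -/
inductive CactusChain : ℕ → Type
  | nil : CactusChain 0
  | cons {k : ℕ} (p q : PlaneCactus) (c : CactusChain k) : CactusChain (k + 1)
end

mutual
/-- The number of polygons of each size in a plane cactus. -/
noncomputable def PlaneCactus.type : PlaneCactus → CycleType
  | .point => 0
  | .attach (k := k) c t =>
    Finsupp.single (⟨k + 2, by omega⟩ : CycleLength) 1 + (c.type + t.type)
/-- The number of polygons of each size in a chain of plane cacti. -/
noncomputable def CactusChain.type : {k : ℕ} → CactusChain k → CycleType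
  | _, .nil => 0
  | _, .cons p q c => (p.type + q.type) + c.type
end

section Draws

variable {X : Type*} [DecidableEq X]

mutual
/-- `PlaneCactus.Draws t r u l`: labelling the vertices of `t`, with root `r`, along the cyclic word
`r :: u`, and reading the polygons in a suitable order as cycles, gives the list `l`. -/
inductive PlaneCactus.Draws : PlaneCactus → X → List X → List (Perm X) → Prop
  | point (r : X) : PlaneCactus.Draws .point r [] []
  | attach {k : ℕ} {c : CactusChain (k + 1)} {t : PlaneCactus} {r : X} {u vs w : List X}
      {l L L' : List (Perm X)} (hn : (r :: (u ++ w)).Nodup) (hc : CactusChain.Draws c vs w L L')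
      (ht : PlaneCactus.Draws t r u l) :
      PlaneCactus.Draws (.attach c t) r (u ++ w) (L ++ (r :: vs).formPerm :: (L' ++ l))
/-- `CactusChain.Draws c vs w L L'`: labelling the chain `c` along the word `w` puts its vertices
at `vs`; the lists `L` and `L'` consist of the cycles to the left and to the right of the polygon,
in a product. -/
inductive CactusChain.Draws : {k : ℕ} → CactusChain k → List X → List X → List (Perm X) →
    List (Perm X) → Prop
  | nil : CactusChain.Draws .nil [] [] [] []
  | cons {k : ℕ} {p q : PlaneCactus} {c : CactusChain k} {v : X} {a b vs w : List X}
      {l l' L L' : List (Perm X)} (hn : (a ++ v :: (b ++ w)).Nodup)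
      (hp : PlaneCactus.Draws p v a l) (hq : PlaneCactus.Draws q v b l')
      (hc : CactusChain.Draws c vs w L L') :
      CactusChain.Draws (.cons p q c) (v :: vs) (a ++ v :: (b ++ w)) (l ++ L) (L' ++ l')
end

variable {k : ℕ} {t : PlaneCactus} {c : CactusChain k} {r : X} {u vs w : List X}
  {l L L' : List (Perm X)}

theorem PlaneCactus.Draws.nodup : t.Draws r u l → (r :: u).Nodup
  | .point r => List.nodup_singleton r
  | .attach hn _ _ => hn

theorem CactusChain.Draws.nodup : c.Draws vs w L L' → w.Nodup
  | .nil => List.nodup_nil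
  | .cons hn _ _ _ => hn

mutual
theorem PlaneCactus.Draws.length_eq {t : PlaneCactus} {r : X} {u : List X} {l : List (Perm X)} :
    t.Draws r u l → u.length = t.type.rank
  | .point r => by simp [PlaneCactus.type]
  | .attach _ hc ht => by
    have h₁ := ht.length_eq
    have h₂ := hc.length_eq
    simp only [PlaneCactus.type, CycleType.rank_add, CycleType.rank_single, List.length_append]
    omega
theorem CactusChain.Draws.length_eq {k : ℕ} {c : CactusChain k} {vs w : List X}
    {L L' : List (Perm X)} : c.Draws vs w L L' → w.length = c.type.rank + k
  | .nil => by simp [CactusChain.type]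
  | .cons _ hp hq hc => by
    have h₁ := hp.length_eq
    have h₂ := hq.length_eq
    have h₃ := hc.length_eq
    simp only [CactusChain.type, CycleType.rank_add, List.length_append, List.length_cons]
    omega
end

theorem CactusChain.Draws.length_vertices {k : ℕ} {c : CactusChain k} {vs w : List X}
    {L L' : List (Perm X)} : c.Draws vs w L L' → vs.length = k
  | .nil => rfl
  | .cons _ _ _ hc => by simp [hc.length_vertices]

theorem CactusChain.Draws.ne_nil {c : CactusChain (k + 1)} (h : c.Draws vs w L L') : vs ≠ [] :=
  List.ne_nil_of_length_eq_add_one h.length_vertices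

theorem CactusChain.Draws.sublist {k : ℕ} {c : CactusChain k} {vs w : List X}
    {L L' : List (Perm X)} : c.Draws vs w L L' → vs.Sublist w
  | .nil => .slnil
  | .cons _ _ _ hc => ((hc.sublist.trans (List.sublist_append_right _ _)).cons_cons _).trans
      (List.sublist_append_right _ _)

theorem exists_eq_append_of_le_length {A : Type*} {n : ℕ} {l : List A} (h : n ≤ l.length) :
    ∃ a b, l = a ++ b ∧ a.length = n :=
  ⟨l.take n, l.drop n, (List.take_append_drop n l).symm, List.length_take_of_le h⟩

mutual
theorem PlaneCactus.exists_draws : ∀ (t : PlaneCactus) {r : X} {u : List X},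
    (r :: u).Nodup → u.length = t.type.rank → ∃ l, t.Draws r u l
  | .point, r, u, _, h => by
    obtain rfl : u = [] := List.length_eq_zero_iff.1 (by simpa [PlaneCactus.type] using h)
    exact ⟨_, .point r⟩
  | .attach c t, r, u, hn, h => by
    simp only [PlaneCactus.type, CycleType.rank_add, CycleType.rank_single] at h
    obtain ⟨u, w, rfl, hu⟩ := exists_eq_append_of_le_length (n := t.type.rank) (l := u) (by omega)
    rw [List.length_append] at h
    obtain ⟨l, hl⟩ := t.exists_draws (r := r) (hn.sublist (by simp)) hu
    obtain ⟨vs, L, L', hc⟩ := c.exists_draws hn.of_cons.of_append_right (by omega)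
    exact ⟨_, .attach hn hc hl⟩
theorem CactusChain.exists_draws : ∀ {k : ℕ} (c : CactusChain k) {w : List X},
    w.Nodup → w.length = c.type.rank + k → ∃ vs L L', c.Draws vs w L L'
  | _, .nil, w, _, h => by
    obtain rfl : w = [] := List.length_eq_zero_iff.1 (by simpa [CactusChain.type] using h)
    exact ⟨_, _, _, .nil⟩
  | _, .cons p q c, w, hn, h => by
    simp only [CactusChain.type, CycleType.rank_add] at h
    obtain ⟨a, x, rfl, ha⟩ := exists_eq_append_of_le_length (n := p.type.rank) (l := w) (by omega)
    rw [List.length_append] at h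
    obtain ⟨v, x, rfl⟩ : ∃ v y, x = v :: y := List.exists_cons_of_length_pos (by omega)
    rw [List.length_cons] at h
    obtain ⟨b, w, rfl, hb⟩ := exists_eq_append_of_le_length (n := q.type.rank) (l := x) (by omega)
    rw [List.length_append] at h
    obtain ⟨l, hl⟩ := p.exists_draws (r := v) ((List.nodup_middle.1 hn).sublist (by simp)) ha
    obtain ⟨l', hl'⟩ := q.exists_draws (r := v) (hn.sublist (by simp)) hb
    obtain ⟨vs, L, L', hc⟩ := c.exists_draws hn.of_append_right.of_cons.of_append_right (by omega)
    exact ⟨_, _, _, .cons hn hl hl' hc⟩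
end

theorem CactusChain.Draws.nodup_cons (h : c.Draws vs w L L') (hn : (r :: w).Nodup) :
    (r :: vs).Nodup :=
  hn.sublist (h.sublist.cons_cons r)

mutual
theorem PlaneCactus.Draws.isCycle {t : PlaneCactus} {r : X} {u : List X}
    {l : List (Perm X)} : t.Draws r u l → ∀ σ ∈ l, σ.IsCycle
  | .point r => by simp
  | .attach (r := r) (vs := vs) hn hc ht => by
    have hcycle := hc.isCycle
    simp only [List.forall_mem_append, List.forall_mem_cons] at hcycle ⊢
    have hnvs : (r :: vs).Nodup := hc.nodup_cons (hn.sublist (by simp))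
    exact ⟨hcycle.1, List.isCycle_formPerm hnvs (by simp [hc.length_vertices]), hcycle.2,
      ht.isCycle⟩
theorem CactusChain.Draws.isCycle {k : ℕ} {c : CactusChain k} {vs w : List X}
    {L L' : List (Perm X)} : c.Draws vs w L L' → ∀ σ ∈ L ++ L', σ.IsCycle
  | .nil => by simp
  | .cons _ hp hq hc => by
    have hcycle := hc.isCycle
    simp only [List.forall_mem_append] at hcycle ⊢
    exact ⟨⟨hp.isCycle, hcycle.1⟩, hcycle.2, hq.isCycle⟩
end

mutual
theorem PlaneCactus.Draws.support_subset [Fintype X] {t : PlaneCactus} {r : X} {u : List X}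
    {l : List (Perm X)} : t.Draws r u l → ∀ σ ∈ l, σ.support ⊆ (r :: u).toFinset
  | .point r => by simp
  | .attach (vs := vs) (u := u) (w := w) _ hc ht => by
    have hu : (r :: u).toFinset ⊆ (r :: (u ++ w)).toFinset := fun x => by
      simp only [List.toFinset_cons, Finset.mem_insert, List.mem_toFinset, List.mem_append]
      tauto
    have hw : w.toFinset ⊆ (r :: (u ++ w)).toFinset := fun x => by simp +contextual
    have hvs : (r :: vs).toFinset ⊆ (r :: (u ++ w)).toFinset := fun x => by
      simp only [List.toFinset_cons, Finset.mem_insert, List.mem_toFinset, List.mem_append]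
      exact Or.imp_right fun h => .inr (hc.sublist.subset h)
    simp only [List.forall_mem_append, List.forall_mem_cons]
    exact ⟨fun σ hσ => (hc.support_subset σ (by simp [hσ])).trans hw,
      (List.support_formPerm_le _).trans hvs,
      fun σ hσ => (hc.support_subset σ (by simp [hσ])).trans hw,
      fun σ hσ => (ht.support_subset σ hσ).trans hu⟩
theorem CactusChain.Draws.support_subset [Fintype X] {k : ℕ} {c : CactusChain k} {vs w : List X}
    {L L' : List (Perm X)} : c.Draws vs w L L' → ∀ σ ∈ L ++ L', σ.support ⊆ w.toFinset
  | .nil => by simp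
  | .cons (a := a) (b := b) (w := w) (v := v) _ hp hq hc => by
    have ha : (v :: a).toFinset ⊆ (a ++ v :: (b ++ w)).toFinset := fun x => by
      simp only [List.mem_toFinset, List.mem_append, List.mem_cons]
      tauto
    have hb : (v :: b).toFinset ⊆ (a ++ v :: (b ++ w)).toFinset := fun x => by
      simp only [List.mem_toFinset, List.mem_append, List.mem_cons]
      tauto
    have hw : w.toFinset ⊆ (a ++ v :: (b ++ w)).toFinset := fun x => by simp +contextual
    simp only [List.forall_mem_append]
    exact ⟨⟨fun σ hσ => (hp.support_subset σ hσ).trans ha,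
      fun σ hσ => (hc.support_subset σ (by simp [hσ])).trans hw⟩,
      fun σ hσ => (hc.support_subset σ (by simp [hσ])).trans hw,
      fun σ hσ => (hq.support_subset σ hσ).trans hb⟩
end

mutual
theorem PlaneCactus.Draws.ofList_eq [Fintype X] {t : PlaneCactus} {r : X} {u : List X}
    {l : List (Perm X)} : t.Draws r u l → CycleType.ofList l = t.type
  | .point r => by simp [PlaneCactus.type]
  | .attach (r := r) (vs := vs) hn hc ht => by
    have hlen := hc.length_vertices
    have hnvs : (r :: vs).Nodup := hc.nodup_cons (hn.sublist (by simp))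
    have hroot := CycleType.ofPerm_formPerm hnvs (by omega)
    have htype := hc.ofList_eq
    simp only [hlen, CycleType.ofList_append] at hroot htype
    simp only [CycleType.ofList_append, CycleType.ofList_cons, PlaneCactus.type, hroot,
      ht.ofList_eq, ← htype]
    abel
theorem CactusChain.Draws.ofList_eq [Fintype X] {k : ℕ} {c : CactusChain k} {vs w : List X}
    {L L' : List (Perm X)} : c.Draws vs w L L' → CycleType.ofList (L ++ L') = c.type
  | .nil => by simp [CactusChain.type]
  | .cons _ hp hq hc => by
    have htype := hc.ofList_eq
    simp only [CycleType.ofList_append] at htype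
    simp only [CycleType.ofList_append, CactusChain.type, hp.ofList_eq, hq.ofList_eq, ← htype]
    abel
end

theorem CactusChain.Draws.commute_formPerm_prod [Finite X] {v : X} (h : c.Draws vs w L L')
    (hn : (r :: v :: w).Nodup) : Commute (List.formPerm [r, v]) L'.prod := by
  have := Fintype.ofFinite X
  refine (Perm.disjoint_prod_right _ fun σ hσ => ?_).commute
  refine Perm.disjoint_iff_disjoint_support.2 (Disjoint.mono (List.support_formPerm_le _)
    (h.support_subset σ (by simp [hσ])) ?_)
  rw [List.disjoint_toFinset_iff_disjoint]
  exact (List.nodup_append'.1 (show ([r, v] ++ w).Nodup from hn)).2.2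

mutual
theorem PlaneCactus.Draws.prod_eq [Finite X] {t : PlaneCactus} {r : X} {u : List X}
    {l : List (Perm X)} : t.Draws r u l → l.prod = (r :: u).formPerm
  | .point r => by simp
  | .attach (vs := vs) (u := u) (w := w) (L := L) (L' := L') (l := l) hn hc ht => by
    have hrw : (r :: w).Nodup := hn.sublist (by simp)
    calc (L ++ (r :: vs).formPerm :: (L' ++ l)).prod
        = L.prod * (r :: vs).formPerm * L'.prod * l.prod := by
          simp only [List.prod_append, List.prod_cons, mul_assoc]
      _ = (r :: (u ++ w)).formPerm := by
          rw [hc.prod_eq hrw, ht.prod_eq, formPerm_mul_formPerm hn, List.cons_append]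
theorem CactusChain.Draws.prod_eq [Finite X] {k : ℕ} {c : CactusChain k} {r : X} {vs w : List X}
    {L L' : List (Perm X)} : c.Draws vs w L L' → (r :: w).Nodup →
      L.prod * (r :: vs).formPerm * L'.prod = (r :: w).formPerm
  | .nil, _ => by simp
  | .cons (v := v) (vs := vs) (a := a) (b := b) (w := w) (l := l) (l' := l') (L := L) (L' := L')
      _ hp hq hc, hn => by
    have hrw : (r :: v :: w).Nodup := hn.sublist (by simp)
    have hrvs : (r :: [v] ++ vs).Nodup := hrw.sublist ((hc.sublist.cons_cons v).cons_cons r)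
    calc (l ++ L).prod * (r :: v :: vs).formPerm * (L' ++ l').prod
        = l.prod * (L.prod * (r :: vs).formPerm * ([r, v].formPerm * L'.prod)) * l'.prod := by
          rw [List.prod_append, List.prod_append,
            show r :: v :: vs = r :: [v] ++ vs from rfl, ← formPerm_mul_formPerm hrvs]
          group
      _ = l.prod * (L.prod * (r :: vs).formPerm * L'.prod * [r, v].formPerm) * l'.prod := by
          rw [hc.commute_formPerm_prod hrw]
          group
      _ = (r :: (a ++ v :: (b ++ w))).formPerm := by
          rw [hc.prod_eq (hrw.sublist (by simp)), hp.prod_eq, hq.prod_eq, formPerm_insert hn]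
end

theorem filter_append_eq_left {A : Type*} {u w : List A} (p : A → Prop) [DecidablePred p]
    (hu : ∀ x ∈ u, p x) (hw : ∀ x ∈ w, ¬ p x) : (u ++ w).filter (fun x => decide (p x)) = u := by
  rw [List.filter_append, List.filter_eq_self.2 (by simpa using hu),
    List.filter_eq_nil_iff.2 (by simpa using hw), List.append_nil]

theorem eq_of_append_eq_append {A : Type*} {u u' w w' : List A} (p : A → Prop)
    (h : u ++ w = u' ++ w') (hu : ∀ x ∈ u, p x) (hu' : ∀ x ∈ u', p x) (hw : ∀ x ∈ w, ¬ p x)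
    (hw' : ∀ x ∈ w', ¬ p x) : u = u' ∧ w = w' := by
  classical
  obtain rfl : u = u' := by
    rw [← filter_append_eq_left p hu hw, h, filter_append_eq_left p hu' hw']
  exact ⟨rfl, List.append_cancel_left h⟩

theorem perm_of_append_perm_append {A : Type*} {l m l' m' : List A} (p : A → Prop)
    (h : (l ++ m).Perm (l' ++ m')) (hl : ∀ x ∈ l, p x) (hl' : ∀ x ∈ l', p x)
    (hm : ∀ x ∈ m, ¬ p x) (hm' : ∀ x ∈ m', ¬ p x) : l.Perm l' ∧ m.Perm m' := by
  classical
  have hll : l.Perm l' := by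
    simpa only [filter_append_eq_left p hl hm, filter_append_eq_left p hl' hm'] using
      h.filter fun x => decide (p x)
  exact ⟨hll, (List.perm_append_left_iff l).1 (h.trans (hll.symm.append_right m'))⟩

theorem perm_of_append_perm_append_of_support [Fintype X] {l m l' m' : List (Perm X)}
    {S T : Finset X} {v : X} (h : (l ++ m).Perm (l' ++ m')) (hST : S ∩ T ⊆ {v})
    (hl : ∀ σ ∈ l, σ.support ⊆ S) (hl' : ∀ σ ∈ l', σ.support ⊆ S)
    (hm : ∀ σ ∈ m, σ.IsCycle ∧ σ.support ⊆ T) (hm' : ∀ σ ∈ m', σ.IsCycle ∧ σ.support ⊆ T) :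
    l.Perm l' ∧ m.Perm m' := by
  have hT (σ : Perm X) (hσ : σ.IsCycle ∧ σ.support ⊆ T) : ¬ σ.support ⊆ S := fun hS => by
    have hle := Finset.card_le_card ((Finset.subset_inter hS hσ.2).trans hST)
    have htwo := hσ.1.two_le_card_support
    rw [Finset.card_singleton] at hle
    omega
  exact perm_of_append_perm_append _ h hl hl' (fun σ hσ => hT σ (hm σ hσ))
    fun σ hσ => hT σ (hm' σ hσ)

theorem disjoint_toFinset_cons_of_nodup (hn : (r :: (u ++ w)).Nodup) :
    Disjoint w.toFinset (r :: u).toFinset := by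
  rw [List.disjoint_toFinset_iff_disjoint]
  exact (List.nodup_append'.1 (show (r :: u ++ w).Nodup from hn)).2.2.symm

theorem PlaneCactus.Draws.toFinset_subset_supportComponent [Fintype X] {m : List (Perm X)}
    (h : t.Draws r u l) (hlm : l ⊆ m) : (r :: u).toFinset ⊆ supportComponent m r := by
  refine subset_of_formPerm_mem h.nodup (self_mem_supportComponent m r) fun x hx => ?_
  rw [← h.prod_eq]
  exact ((supportClosed_supportComponent m r).mono hlm).prod_apply_mem hx

theorem toFinset_cons_append (v : X) (a b : List X) :
    (v :: (a ++ b)).toFinset = (v :: a).toFinset ∪ (v :: b).toFinset := by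
  ext x
  simp only [List.mem_toFinset, List.mem_cons, List.mem_append, Finset.mem_union]
  tauto

theorem PlaneCactus.Draws.isCycle_and_support_subset [Fintype X] (h : t.Draws r u l) :
    ∀ σ ∈ l, σ.IsCycle ∧ σ.support ⊆ (r :: u).toFinset :=
  fun σ hσ => ⟨h.isCycle σ hσ, h.support_subset σ hσ⟩

theorem CactusChain.Draws.isCycle_and_support_subset [Fintype X] (h : c.Draws vs w L L') :
    ∀ σ ∈ L ++ L', σ.IsCycle ∧ σ.support ⊆ w.toFinset :=
  fun σ hσ => ⟨h.isCycle σ hσ, h.support_subset σ hσ⟩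

section Injective

variable {k' : ℕ} {t' : PlaneCactus} {u' vs' w' : List X} {l' M M' : List (Perm X)}

section Attach

variable {c : CactusChain (k + 1)} {c' : CactusChain (k' + 1)}

theorem CactusChain.Draws.formPerm_eq_of_isPrefix [Finite X] (hc : c.Draws vs w L L')
    (ht : t.Draws r u l) (hc' : c'.Draws vs' w' M M') (hu : u <+: u') (hn : (r :: (u ++ w)).Nodup)
    (hn' : (r :: (u' ++ w')).Nodup)
    (hσ : (r :: vs').formPerm ∈ L ++ (r :: vs).formPerm :: (L' ++ l)) :
    (r :: vs).formPerm = (r :: vs').formPerm := by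
  have := Fintype.ofFinite X
  have hrw' : (r :: w').Nodup := hn'.sublist (by simp)
  have hsupp := support_formPerm_cons (hc'.nodup_cons hrw') hc'.ne_nil
  obtain ⟨v, hv⟩ := List.exists_mem_of_ne_nil _ hc'.ne_nil
  have hLL : (r :: vs').formPerm ∉ L ++ L' := fun h => by
    have hrw := hc.support_subset _ h (by simp [hsupp] : r ∈ _)
    exact (List.nodup_cons.1 hn).1 (List.mem_append_right _ (List.mem_toFinset.1 hrw))
  have hl : (r :: vs').formPerm ∉ l := fun h => by
    have hvu := ht.support_subset _ h (by simp [hsupp, hv] : v ∈ _)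
    have hvw := hc'.sublist.subset hv
    simp only [List.toFinset_cons, Finset.mem_insert, List.mem_toFinset] at hvu
    rcases hvu with rfl | hvu
    · exact (List.nodup_cons.1 hrw').1 hvw
    · exact List.disjoint_of_nodup_append hn'.of_cons (hu.subset hvu) hvw
  simp only [List.mem_append, List.mem_cons, not_or] at hσ hLL
  tauto

theorem CactusChain.Draws.vertices_eq [Finite X] (hc : c.Draws vs w L L') (ht : t.Draws r u l)
    (hc' : c'.Draws vs' w' M M') (ht' : t'.Draws r u' l') (hn : (r :: (u ++ w)).Nodup)
    (hu : u ++ w = u' ++ w') (hperm : (L ++ (r :: vs).formPerm :: (L' ++ l)).Perm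
      (M ++ (r :: vs').formPerm :: (M' ++ l'))) : vs = vs' := by
  have hn' := hu ▸ hn
  have hrw : (r :: w).Nodup := hn.sublist (by simp)
  have hrw' : (r :: w').Nodup := hn'.sublist (by simp)
  refine eq_of_formPerm_cons_eq (hc.nodup_cons hrw) (hc'.nodup_cons hrw') ?_
  rcases List.append_eq_append_iff.1 hu with ⟨x, hx, -⟩ | ⟨x, hx, -⟩
  · exact hc.formPerm_eq_of_isPrefix ht hc' ⟨x, hx.symm⟩ hn hn' (hperm.symm.subset (by simp))
  · exact (hc'.formPerm_eq_of_isPrefix ht' hc ⟨x, hx.symm⟩ hn' hn (hperm.subset (by simp))).symm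

end Attach

variable {c c' : CactusChain k}

theorem CactusChain.Draws.supportComponent_eq [Fintype X] (hc : c.Draws vs w L L')
    (ht : t.Draws r u l) (hn : (r :: (u ++ w)).Nodup) :
    supportComponent (l ++ (L ++ L')) r = (r :: u).toFinset :=
  supportComponent_append_eq ht.support_subset
    (fun σ hσ => (disjoint_toFinset_cons_of_nodup hn).mono_left (hc.support_subset σ hσ)) (by simp)
    (ht.toFinset_subset_supportComponent (List.Subset.refl l))

theorem CactusChain.Draws.attach_inj [Finite X] (hc : c.Draws vs w L L') (ht : t.Draws r u l)
    (hc' : c'.Draws vs' w' M M') (ht' : t'.Draws r u' l') (hn : (r :: (u ++ w)).Nodup)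
    (hu : u ++ w = u' ++ w') (hperm : (l ++ (L ++ L')).Perm (l' ++ (M ++ M'))) :
    (u = u' ∧ w = w') ∧ l.Perm l' ∧ (L ++ L').Perm (M ++ M') := by
  have := Fintype.ofFinite X
  have hn' := hu ▸ hn
  have hS : (r :: u).toFinset = (r :: u').toFinset := by
    rw [← hc.supportComponent_eq ht hn, ← hc'.supportComponent_eq ht' hn',
      supportComponent_perm hperm]
  have hd := disjoint_toFinset_cons_of_nodup hn
  have hd' := disjoint_toFinset_cons_of_nodup hn'
  obtain ⟨rfl, rfl⟩ := eq_of_append_eq_append (· ∈ (r :: u).toFinset) hu (by simp +contextual)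
    (by rw [hS]; simp +contextual) (fun x hx => Finset.disjoint_left.1 hd (by simpa using hx))
    (fun x hx => hS ▸ Finset.disjoint_left.1 hd' (by simpa using hx))
  exact ⟨⟨rfl, rfl⟩, perm_of_append_perm_append_of_support (v := r) hperm
    (by simp [Finset.disjoint_iff_inter_eq_empty.1 hd.symm, - List.toFinset_cons]) ht.support_subset
    ht'.support_subset hc.isCycle_and_support_subset hc'.isCycle_and_support_subset⟩

variable {p q p' q' : PlaneCactus} {v : X} {a b b' : List X} {m m' : List (Perm X)}

theorem PlaneCactus.Draws.support_subset_append [Fintype X] (hp : p.Draws v a l)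
    (hq : q.Draws v b l') : ∀ σ ∈ l ++ l', σ.support ⊆ (v :: (a ++ b)).toFinset := by
  rw [toFinset_cons_append]
  exact List.forall_mem_append.2
    ⟨fun σ hσ => (hp.support_subset σ hσ).trans Finset.subset_union_left,
      fun σ hσ => (hq.support_subset σ hσ).trans Finset.subset_union_right⟩

theorem CactusChain.Draws.supportComponent_cons_eq [Fintype X] (hp : p.Draws v a l)
    (hq : q.Draws v b l') (hc : c.Draws vs w L L') (hn : (a ++ v :: (b ++ w)).Nodup) :
    supportComponent ((l ++ l') ++ (L ++ L')) v = (v :: (a ++ b)).toFinset := by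
  have hn' : (v :: (a ++ b ++ w)).Nodup := by simpa using List.nodup_middle.1 hn
  refine supportComponent_append_eq (hp.support_subset_append hq) (fun σ hσ =>
    (disjoint_toFinset_cons_of_nodup hn').mono_left (hc.support_subset σ hσ)) (by simp) ?_
  rw [toFinset_cons_append]
  exact Finset.union_subset (hp.toFinset_subset_supportComponent (by simp))
    (hq.toFinset_subset_supportComponent (by simp))

theorem CactusChain.Draws.cons_inj [Finite X] (hp : p.Draws v a l) (hq : q.Draws v b l')
    (hc : c.Draws vs w L L') (hp' : p'.Draws v a m) (hq' : q'.Draws v b' m')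
    (hc' : c'.Draws vs w' M M') (hn : (a ++ v :: (b ++ w)).Nodup) (hw : b ++ w = b' ++ w')
    (hperm : ((l ++ l') ++ (L ++ L')).Perm ((m ++ m') ++ (M ++ M'))) :
    (b = b' ∧ w = w') ∧ l.Perm m ∧ l'.Perm m' ∧ (L ++ L').Perm (M ++ M') := by
  have := Fintype.ofFinite X
  have hn' := hw ▸ hn
  have hS : (v :: (a ++ b)).toFinset = (v :: (a ++ b')).toFinset := by
    rw [← CactusChain.Draws.supportComponent_cons_eq hp hq hc hn,
      ← CactusChain.Draws.supportComponent_cons_eq hp' hq' hc' hn',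
      supportComponent_perm hperm]
  have hd := disjoint_toFinset_cons_of_nodup (u := a ++ b) (by simpa using List.nodup_middle.1 hn)
  have hd' := disjoint_toFinset_cons_of_nodup (u := a ++ b')
    (by simpa using List.nodup_middle.1 hn')
  obtain ⟨rfl, rfl⟩ := eq_of_append_eq_append (· ∈ (v :: (a ++ b)).toFinset) hw
    (by simp +contextual) (by rw [hS]; simp +contextual)
    (fun x hx => Finset.disjoint_left.1 hd (by simpa using hx))
    (fun x hx => hS ▸ Finset.disjoint_left.1 hd' (by simpa using hx))
  have hab : (v :: a).toFinset ∩ (v :: b).toFinset ⊆ {v} := fun x => by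
    simp only [List.toFinset_cons, Finset.mem_inter, Finset.mem_insert, List.mem_toFinset,
      Finset.mem_singleton, ← or_and_left]
    exact fun h => h.resolve_right fun ⟨ha, hb⟩ =>
      List.disjoint_of_nodup_append hn ha (by simp [hb])
  obtain ⟨hl, hL⟩ := perm_of_append_perm_append_of_support (v := v) hperm
    (by simp [Finset.disjoint_iff_inter_eq_empty.1 hd.symm, - List.toFinset_cons])
    (hp.support_subset_append hq) (hp'.support_subset_append hq')
    hc.isCycle_and_support_subset hc'.isCycle_and_support_subset
  obtain ⟨h, h'⟩ := perm_of_append_perm_append_of_support hl hab hp.support_subset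
    hp'.support_subset hq.isCycle_and_support_subset hq'.isCycle_and_support_subset
  exact ⟨⟨rfl, rfl⟩, h, h', hL⟩

end Injective

theorem perm_append_middle {A : Type*} (a b c d : List A) :
    ((a ++ b) ++ (c ++ d)).Perm ((a ++ c) ++ (d ++ b)) := by
  simp only [List.append_assoc]
  exact (List.perm_append_comm.trans (by simp)).append_left a

mutual
theorem PlaneCactus.Draws.injective [Finite X] : ∀ {t t' : PlaneCactus} {r : X} {u u' : List X}
    {l l' : List (Perm X)}, t.Draws r u l → t'.Draws r u' l' → u = u' → l.Perm l' → t = t'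
  | _, _, _, _, _, _, _, .point _, .point _ => fun _ _ => rfl
  | _, _, _, _, _, _, _, .point _, .attach _ _ _ => fun _ h => by simpa using h.length_eq
  | _, _, _, _, _, _, _, .attach _ _ _, .point _ => fun _ h => by simpa using h.length_eq
  | _, _, _, _, _, _, _, .attach (k := k) hn hc ht, .attach (k := k') _ hc' ht' =>
    fun hu hperm => by
    obtain rfl := hc.vertices_eq ht hc' ht' hn hu hperm
    obtain rfl : k = k' := Nat.succ_injective (hc.length_vertices.symm.trans hc'.length_vertices)
    have hcancel := (List.perm_middle.symm.trans (hperm.trans List.perm_middle)).cons_inv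
    simp only [← List.append_assoc] at hcancel
    obtain ⟨⟨rfl, rfl⟩, hl, hL⟩ := hc.attach_inj ht hc' ht' hn hu
      (List.perm_append_comm.trans (hcancel.trans List.perm_append_comm))
    rw [hc.injective hc' rfl rfl hL, ht.injective ht' rfl hl]
theorem CactusChain.Draws.injective [Finite X] : ∀ {k : ℕ} {c c' : CactusChain k}
    {vs vs' w w' : List X} {L L' M M' : List (Perm X)}, c.Draws vs w L L' →
      c'.Draws vs' w' M M' → vs = vs' → w = w' → (L ++ L').Perm (M ++ M') → c = c'
  | _, _, _, _, _, _, _, _, _, _, _, .nil, .nil => fun _ _ _ => rfl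
  | _, _, _, _, _, _, _, _, _, _, _, .cons (v := v) (a := a) hn hp hq hc,
      .cons (a := a') hn' hp' hq' hc' => fun hvs hw hperm => by
    obtain ⟨rfl, rfl⟩ := List.cons.inj hvs
    have hva : v ∉ a := fun h => List.disjoint_of_nodup_append hn h (by simp)
    have hvbw := (List.nodup_cons.1 hn.of_append_right).1
    obtain ⟨rfl, -, hbw⟩ := (List.append_cons_inj_of_notMem hva hvbw).1 hw
    obtain ⟨⟨rfl, rfl⟩, hl, hl', hL⟩ := CactusChain.Draws.cons_inj hp hq hc hp' hq' hc' hn hbw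
      ((perm_append_middle _ _ _ _).trans (hperm.trans (perm_append_middle _ _ _ _).symm))
    rw [hp.injective hp' rfl hl, hq.injective hq' rfl hl', hc.injective hc' rfl rfl hL]
end

end Draws

theorem mem_and_mem_of_val_add_val {X : Type*} {V V₁ V₂ : Finset X} {v : X}
    (h : V₁.val + V₂.val = v ::ₘ V.val) (hv : v ∈ V) : v ∈ V₁ ∧ v ∈ V₂ := by
  classical
  have hcount := congrArg (Multiset.count v) h
  rw [Multiset.count_add, Multiset.count_cons_self, Multiset.count_eq_one_of_mem V.nodup hv]
    at hcount
  have h₁ := Multiset.nodup_iff_count_le_one.1 V₁.nodup v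
  have h₂ := Multiset.nodup_iff_count_le_one.1 V₂.nodup v
  exact ⟨Multiset.count_pos.1 (by omega), Multiset.count_pos.1 (by omega)⟩

section Existence

variable {X : Type*} [DecidableEq X] [Fintype X] {A B l : List (Perm X)} {σ : Perm X}
  {V : Finset X} {r v : X}

theorem IsHypertree.exists_split_left (h : IsHypertree (A ++ σ :: B) V) (hv : v ∈ σ.support) :
    ∃ (l A' B' : List (Perm X)) (V₁ V₂ : Finset X), IsHypertree l V₁ ∧
      IsHypertree (A' ++ σ :: B') V₂ ∧ V₁.val + V₂.val = v ::ₘ V.val ∧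
      TraceEquiv (A ++ σ :: B) (l ++ (A' ++ σ :: B')) ∧ (∀ τ ∈ A', τ ∈ A ∧ v ∉ τ.support) ∧
      B' ⊆ B := by
  obtain ⟨p, V₁, V₂, h₁, h₂, hV, htrace, hA, hB⟩ :=
    h.exists_traceEquiv_filter (h.support_subset σ (by simp) hv)
  have hp : p σ = false := hB σ (by simp) hv
  have hfilter : (A ++ σ :: B).filter (fun τ => !p τ) =
      A.filter (fun τ => !p τ) ++ σ :: B.filter fun τ => !p τ := by simp [hp]
  rw [hfilter] at h₂ htrace
  refine ⟨_, _, _, V₁, V₂, h₁, h₂, hV, htrace, fun τ hτ => ?_, List.filter_subset_self _⟩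
  rw [List.mem_filter] at hτ
  exact ⟨hτ.1, fun hvτ => by simp [hA τ hτ.1 hvτ] at hτ⟩

theorem IsHypertree.exists_split_right (h : IsHypertree (A ++ σ :: B) V) (hv : v ∈ σ.support) :
    ∃ (l A' B' : List (Perm X)) (V₁ V₂ : Finset X), IsHypertree (A' ++ σ :: B') V₁ ∧
      IsHypertree l V₂ ∧ V₁.val + V₂.val = v ::ₘ V.val ∧
      TraceEquiv (A ++ σ :: B) (A' ++ σ :: B' ++ l) ∧ A' ⊆ A ∧
      ∀ τ ∈ B', τ ∈ B ∧ v ∉ τ.support := by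
  rw [List.append_cons] at h
  obtain ⟨p, V₁, V₂, h₁, h₂, hV, htrace, hA, hB⟩ :=
    h.exists_traceEquiv_filter (h.support_subset σ (by simp) hv)
  have hp : p σ = true := hA σ (by simp) hv
  have hfilter : (A ++ [σ] ++ B).filter p = A.filter p ++ σ :: B.filter p := by simp [hp]
  rw [hfilter] at h₁ htrace
  refine ⟨_, _, _, V₁, V₂, h₁, h₂, hV, by simpa using htrace, List.filter_subset_self _,
    fun τ hτ => ?_⟩
  rw [List.mem_filter] at hτ
  exact ⟨hτ.1, fun hvτ => by simp [hB τ hτ.1 hvτ] at hτ⟩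

theorem IsHypertree.eq_of_disjoint {S : Finset X} (h : IsHypertree (A ++ σ :: B) V)
    (hσ : σ.support = S) (hS : ∀ τ ∈ A ++ B, Disjoint τ.support S) : A ++ B = [] ∧ V = S := by
  obtain ⟨x, hx⟩ := (h.isCycle σ (by simp)).nonempty_support
  have hSV : S ⊆ V := hσ ▸ h.support_subset σ (by simp)
  have hVS : V ⊆ S := (h.connected x (hSV (hσ ▸ hx))).trans <|
    supportComponent_subset (fun τ hτ => by grind) (hσ ▸ hx)
  refine ⟨List.eq_nil_iff_forall_not_mem.2 fun τ hτ => ?_, hVS.antisymm hSV⟩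
  have hτ' : τ ∈ A ++ σ :: B := List.perm_middle.symm.subset (List.mem_cons_of_mem _ hτ)
  obtain ⟨y, hy⟩ := (h.isCycle τ hτ').nonempty_support
  exact Finset.disjoint_left.1 (hS τ hτ) hy (hVS (h.support_subset τ hτ' hy))

theorem IsHypertree.eq_nil_of_notMem_support (h : IsHypertree l V) (hr : r ∈ V)
    (hl : ∀ σ ∈ l, r ∉ σ.support) : l = [] ∧ V = {r} := by
  have hVr : V = {r} := ((h.connected r hr).trans <| supportComponent_subset
    (fun σ hσ => .inl (Finset.disjoint_singleton_right.2 (hl σ hσ))) (by simp)).antisymm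
      (Finset.singleton_subset_iff.2 hr)
  refine ⟨List.eq_nil_iff_forall_not_mem.2 fun σ hσ => ?_, hVr⟩
  have hle := Finset.card_le_card (hVr ▸ h.support_subset σ hσ)
  have htwo := (h.isCycle σ hσ).two_le_card_support
  rw [Finset.card_singleton] at hle
  omega

/-- Up to exchanges of commuting neighbours, the list `l` is drawn by a plane cactus with root `r`
and vertex set `V`. -/
def IsDrawn (l : List (Perm X)) (V : Finset X) (r : X) : Prop :=
  ∃ (t : PlaneCactus) (u : List X) (l' : List (Perm X)),
    t.Draws r u l' ∧ TraceEquiv l l' ∧ V.val = r ::ₘ ↑u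

theorem IsHypertree.exists_chain {N : ℕ} (ih : ∀ (l : List (Perm X)) (V : Finset X) (r : X),
    l.length < N → IsHypertree l V → r ∈ V → IsDrawn l V r) (vs : List X) {S : Multiset X}
    (hlen : A.length + B.length < N) (h : IsHypertree (A ++ σ :: B) V)
    (hσ : σ.support.val = S + ↑vs) (hS : ∀ τ ∈ A ++ B, ∀ x ∈ S, x ∉ τ.support) :
    ∃ (c : CactusChain vs.length) (w : List X) (L L' : List (Perm X)), c.Draws vs w L L' ∧
      TraceEquiv (A ++ σ :: B) (L ++ σ :: L') ∧ V.val = S + ↑w := by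
  induction vs generalizing A B V S with
  | nil =>
    have hσS : ∀ x ∈ σ.support, x ∈ S := fun x hx => by
      simpa [← Finset.mem_val, hσ] using hx
    obtain ⟨hnil, rfl⟩ := h.eq_of_disjoint rfl fun τ hτ =>
      Finset.disjoint_right.2 fun x hx => hS τ hτ x (hσS x hx)
    obtain ⟨rfl, rfl⟩ := List.append_eq_nil_iff.1 hnil
    exact ⟨.nil, [], [], [], .nil, .refl _, hσ⟩
  | cons v vs ihv =>
    have hv : v ∈ σ.support := by simp [← Finset.mem_val, hσ]
    obtain ⟨l, A₁, B₁, V₁, V₂, h₁, h₂, hV, htrace, hA₁, hB₁⟩ := h.exists_split_left hv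
    obtain ⟨l', A₂, B₂, V₃, V₄, h₃, h₄, hV', htrace', hA₂, hB₂⟩ := h₂.exists_split_right hv
    have hlen₁ := htrace.perm.length_eq
    have hlen₂ := htrace'.perm.length_eq
    simp only [List.length_append, List.length_cons] at hlen₁ hlen₂
    have hvV₁ := (mem_and_mem_of_val_add_val hV (h.support_subset σ (by simp) hv)).1
    have hvV₄ := (mem_and_mem_of_val_add_val hV' (h₂.support_subset σ (by simp) hv)).2
    obtain ⟨p, a, m, hp, hlm, ha⟩ := ih l V₁ v (by omega) h₁ hvV₁
    obtain ⟨q, b, m', hq, hlm', hb⟩ := ih l' V₄ v (by omega) h₄ hvV₄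
    have hS' : ∀ τ ∈ A₂ ++ B₂, ∀ x ∈ v ::ₘ S, x ∉ τ.support := by
      simp only [Multiset.mem_cons, forall_eq_or_imp]
      grind
    obtain ⟨c, w, L, L', hc, hL, hw⟩ :=
      ihv (by omega) h₃ (by simp [hσ, ← Multiset.cons_coe]) hS'
    have hVval : V.val = S + ↑(a ++ v :: (b ++ w)) := by
      rw [ha, Multiset.cons_add, Multiset.cons_inj_right] at hV
      rw [hw, hb, Multiset.add_cons, Multiset.cons_inj_right] at hV'
      rw [← hV, ← hV']
      simp only [← Multiset.coe_add, ← Multiset.cons_coe, ← Multiset.singleton_add]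
      abel
    refine ⟨.cons p q c, _, _, _, .cons ?_ hp hq hc, ?_, hVval⟩
    · exact Multiset.coe_nodup.1 (Multiset.nodup_of_le (hVval ▸ Multiset.le_add_left _ _) V.nodup)
    · have h := htrace.trans (hlm.append (htrace'.trans (hL.append hlm')))
      simpa using h

theorem exists_formPerm_cons_eq (hσ : σ.IsCycle) (hr : r ∈ σ.support) :
    ∃ v vs, (r :: v :: vs).Nodup ∧ List.formPerm (r :: v :: vs) = σ := by
  have hform : (σ.toList r).formPerm = σ := by
    rw [Perm.formPerm_toList, hσ.cycleOf_eq (Perm.mem_support.1 hr)]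
  have hlen := Perm.two_le_length_toList_iff_mem_support.2 hr
  rcases hl : σ.toList r with - | ⟨x, - | ⟨y, vs⟩⟩
  · simp [hl] at hlen
  · simp [hl] at hlen
  obtain rfl : x = r := by simpa [hl] using Perm.toList_getElem_zero σ r hr
  exact ⟨y, vs, hl ▸ Perm.nodup_toList σ x, hl ▸ hform⟩

theorem IsHypertree.isDrawn (h : IsHypertree l V) (hr : r ∈ V) : IsDrawn l V r := by
  induction hN : l.length using Nat.strong_induction_on generalizing l V r with
  | _ N ih =>
    replace ih (l) (V : Finset X) (r) (hl : l.length < N) (h : IsHypertree l V) (hr : r ∈ V) :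
        IsDrawn l V r := ih _ hl h hr rfl
    rcases hfind : l.find? (fun σ => decide (r ∈ σ.support)) with - | σ
    · obtain ⟨rfl, rfl⟩ := h.eq_nil_of_notMem_support hr (by simpa using hfind)
      exact ⟨.point, [], [], .point r, .refl _, rfl⟩
    obtain ⟨hσ, A, B, rfl, hA⟩ := List.find?_eq_some_iff_append.1 hfind
    rw [decide_eq_true_iff] at hσ
    obtain ⟨l', A', B', V₁, V₂, h₁, h₂, hV, htrace, hA', hB'⟩ := h.exists_split_right hσ
    obtain ⟨v, vs, hn, rfl⟩ := exists_formPerm_cons_eq (h.isCycle σ (by simp)) hσ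
    have hlen := htrace.perm.length_eq
    simp only [List.length_append, List.length_cons] at hlen hN
    obtain ⟨t, u, m, ht, hm, hu⟩ := ih l' V₂ r (by omega) h₂ (mem_and_mem_of_val_add_val hV hr).2
    have hsupp : (r :: v :: vs).formPerm.support.val = {r} + ↑(v :: vs) := by
      rw [support_formPerm_cons hn (by simp), List.toFinset_val, hn.dedup]
      rfl
    have hfirst : ∀ τ ∈ A' ++ B', ∀ x ∈ ({r} : Multiset X), x ∉ τ.support := by
      simp only [Multiset.mem_singleton, forall_eq, List.mem_append]
      rintro τ (hτ | hτ)
      · simpa using hA τ (hA' hτ)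
      · exact (hB' τ hτ).2
    obtain ⟨c, w, L, L', hc, hL, hw⟩ := h₁.exists_chain ih (v :: vs) (by omega) hsupp hfirst
    have hVval : V.val = r ::ₘ ↑(u ++ w) := by
      rw [hw, hu, Multiset.add_cons, Multiset.cons_inj_right] at hV
      rw [← hV, Multiset.singleton_add, Multiset.cons_add, Multiset.coe_add,
        Multiset.coe_eq_coe.2 List.perm_append_comm]
    refine ⟨.attach c t, _, _, .attach ?_ hc ht, ?_, hVval⟩
    · exact Multiset.coe_nodup.1 (by rw [← Multiset.cons_coe, ← hVval]; exact V.nodup)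
    · exact htrace.trans (by simpa using hL.append hm)

end Existence

section Factorization

variable {X : Type*} [DecidableEq X] [Fintype X] {l : List (Perm X)} {r : X} {u : List X}

theorem IsHypertree.of_prod_eq_formPerm (hcycle : ∀ σ ∈ l, σ.IsCycle)
    (hsupp : ∀ σ ∈ l, σ.support ⊆ (r :: u).toFinset) (hn : (r :: u).Nodup)
    (hprod : l.prod = (r :: u).formPerm) (hrank : totalRank l = u.length) :
    IsHypertree l (r :: u).toFinset := by
  refine .of_root hcycle hsupp (r := r) (subset_of_formPerm_mem hn
    (self_mem_supportComponent l r) fun x hx => ?_) ?_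
  · rw [← hprod]
    exact (supportClosed_supportComponent l r).prod_apply_mem hx
  · rw [List.toFinset_card_of_nodup hn, hrank, List.length_cons]

theorem PlaneCactus.exists_draws_traceEquiv (hcycle : ∀ σ ∈ l, σ.IsCycle)
    (hsupp : ∀ σ ∈ l, σ.support ⊆ (r :: u).toFinset) (hn : (r :: u).Nodup)
    (hprod : l.prod = (r :: u).formPerm) (hrank : totalRank l = u.length) :
    ∃ (t : PlaneCactus) (l' : List (Perm X)), t.Draws r u l' ∧ TraceEquiv l l' := by
  obtain ⟨t, w, l', ht, htrace, -⟩ :=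
    (IsHypertree.of_prod_eq_formPerm hcycle hsupp hn hprod hrank).isDrawn (r := r) (by simp)
  obtain rfl : w = u := eq_of_formPerm_cons_eq ht.nodup hn <| by
    rw [← ht.prod_eq, ← htrace.prod_eq, hprod]
  exact ⟨t, l', ht, htrace⟩

end Factorization

mutual
theorem PlaneCactus.Draws.unique {X : Type*} [DecidableEq X] : ∀ {t : PlaneCactus} {r : X}
    {u u' : List X} {l l' : List (Perm X)}, t.Draws r u l → t.Draws r u' l' → u = u' → l = l'
  | _, _, _, _, _, _, .point r, .point _ => fun _ => rfl
  | _, _, _, _, _, _, .attach _ hc ht, .attach _ hc' ht' => fun hu => by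
    obtain ⟨rfl, rfl⟩ := List.append_inj hu (by rw [ht.length_eq, ht'.length_eq])
    obtain ⟨rfl, rfl, rfl⟩ := hc.unique hc' rfl
    rw [ht.unique ht' rfl]
theorem CactusChain.Draws.unique {X : Type*} [DecidableEq X] : ∀ {k : ℕ} {c : CactusChain k}
    {vs vs' w w' : List X} {L L' M M' : List (Perm X)}, c.Draws vs w L L' →
      c.Draws vs' w' M M' → w = w' → vs = vs' ∧ L = M ∧ L' = M'
  | _, _, _, _, _, _, _, _, _, _, .nil, .nil => fun _ => ⟨rfl, rfl, rfl⟩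
  | _, _, _, _, _, _, _, _, _, _, .cons _ hp hq hc, .cons _ hp' hq' hc' => fun hw => by
    obtain ⟨rfl, hw'⟩ := List.append_inj hw (by rw [hp.length_eq, hp'.length_eq])
    obtain ⟨rfl, hw''⟩ := List.cons.inj hw'
    obtain ⟨rfl, rfl⟩ := List.append_inj hw'' (by rw [hq.length_eq, hq'.length_eq])
    obtain ⟨rfl, rfl, rfl⟩ := hc.unique hc' rfl
    rw [hp.unique hp' rfl, hq.unique hq' rfl]
    exact ⟨rfl, rfl, rfl⟩
end

theorem formPerm_finRange (n : ℕ) : (List.finRange n).formPerm = finRotate n := by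
  ext i
  have := i.neZero
  have h := List.formPerm_apply_getElem (List.finRange n) (List.nodup_finRange n) i (by simp)
  simp only [List.getElem_finRange, List.length_finRange, Fin.cast_mk, Fin.eta] at h
  simp [h, finRotate_apply, Fin.val_add]

theorem isFactorization_iff {n : ℕ} {α : CycleType} {l : List (Perm (Fin n))} :
    IsFactorization n α l ↔
      (∀ σ ∈ l, σ.IsCycle) ∧ l.prod = finRotate n ∧ CycleType.ofList l = α := by
  simp only [Finsupp.ext_iff, CycleType.ofList_apply]
  exact ⟨fun h => ⟨h.isCycle, h.prod_eq, h.count_eq⟩, fun h => ⟨h.1, h.2.1, h.2.2⟩⟩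

/-- The letters after `0` in the cyclic word `0 1 … n` of the rotation of `Fin (n + 1)`. -/
def rotationTail (n : ℕ) : List (Fin (n + 1)) := (List.finRange n).map Fin.succ

theorem cons_rotationTail (n : ℕ) : 0 :: rotationTail n = List.finRange (n + 1) :=
  List.finRange_succ.symm

theorem nodup_cons_rotationTail (n : ℕ) : (0 :: rotationTail n).Nodup :=
  cons_rotationTail n ▸ List.nodup_finRange _

theorem length_rotationTail (n : ℕ) : (rotationTail n).length = n := by
  simp [rotationTail]

theorem formPerm_cons_rotationTail (n : ℕ) :
    (0 :: rotationTail n).formPerm = finRotate (n + 1) := by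
  rw [cons_rotationTail, formPerm_finRange]

theorem PlaneCactus.Draws.isFactorization {n : ℕ} {t : PlaneCactus}
    {l : List (Perm (Fin (n + 1)))} (h : t.Draws 0 (rotationTail n) l) :
    IsFactorization (n + 1) t.type l :=
  isFactorization_iff.2 ⟨h.isCycle, by rw [h.prod_eq, formPerm_cons_rotationTail], h.ofList_eq⟩

theorem IsFactorization.exists_draws {n : ℕ} {α : CycleType} {l : List (Perm (Fin (n + 1)))}
    (h : IsFactorization (n + 1) α l) (hα : α.rank = n) :
    ∃ (t : PlaneCactus) (l' : List (Perm (Fin (n + 1)))),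
      t.type = α ∧ t.Draws 0 (rotationTail n) l' ∧ TraceEquiv l l' := by
  obtain ⟨hcycle, hprod, rfl⟩ := isFactorization_iff.1 h
  have hsupp : ∀ σ ∈ l, σ.support ⊆ (0 :: rotationTail n).toFinset := fun σ _ => by
    simp [cons_rotationTail]
  obtain ⟨t, l', ht, htrace⟩ := PlaneCactus.exists_draws_traceEquiv hcycle hsupp
    (nodup_cons_rotationTail n) (hprod.trans (formPerm_cons_rotationTail n).symm)
    (by rw [← CycleType.rank_ofList, hα, length_rotationTail])
  exact ⟨t, l', by rw [← ht.ofList_eq, CycleType.ofList_perm htrace.perm], ht, htrace⟩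

theorem exists_planeCactus_bijective (α : CycleType) :
    ∃ f : {t : PlaneCactus // t.type = α} → Quotient (factorizationSetoid (α.rank + 1) α),
      Function.Bijective f := by
  choose F hF using fun t : {t : PlaneCactus // t.type = α} => t.1.exists_draws
    (nodup_cons_rotationTail α.rank) ((length_rotationTail _).trans (congrArg _ t.2.symm))
  have hfact (t) : IsFactorization (α.rank + 1) α (F t) := by
    simpa only [t.2] using (hF t).isFactorization
  refine ⟨fun t => ⟦⟨F t, hfact t, rfl⟩⟧, fun t t' h => ?_, fun x => ?_⟩
  · have htrace : TraceEquiv (F t) (F t') :=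
      TraceEquiv.eqvGen_commutingSwap_iff.1 (Quotient.exact h)
    exact Subtype.ext ((hF t).injective (hF t') rfl htrace.perm)
  · obtain ⟨⟨l, hl, hrank⟩, rfl⟩ := Quotient.exists_rep x
    obtain ⟨t, l', hα, ht, htrace⟩ := hl.exists_draws rfl
    refine ⟨⟨t, hα⟩, Quotient.sound (TraceEquiv.eqvGen_commutingSwap_iff.2 ?_)⟩
    exact (hF ⟨t, hα⟩).unique ht rfl ▸ htrace.symm

theorem Htilde_eq_card (α : CycleType) :
    Htilde α = Nat.card {t : PlaneCactus // t.type = α} :=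
  have ⟨_, hf⟩ := exists_planeCactus_bijective α
  (Nat.card_eq_of_bijective _ hf).symm

theorem length_le_totalRank {X : Type*} [DecidableEq X] [Fintype X] {l : List (Perm X)}
    (h : ∀ σ ∈ l, σ.IsCycle) : l.length ≤ totalRank l := by
  induction l with
  | nil => simp
  | cons σ l ih =>
    rw [List.forall_mem_cons] at h
    have htwo := h.1.two_le_card_support
    have hle := ih h.2
    rw [totalRank_cons, List.length_cons]
    omega

theorem finite_minimalFactorization (n : ℕ) (α : CycleType) :
    Finite (MinimalFactorization n α) := by
  refine ((List.finite_length_le (Perm (Fin n)) α.rank).subset ?_).to_subtype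
  rintro l ⟨hl, -⟩
  obtain ⟨hcycle, -, rfl⟩ := isFactorization_iff.1 hl
  exact (length_le_totalRank hcycle).trans_eq (CycleType.rank_ofList l).symm

theorem PlaneCactus.finite_type_eq (α : CycleType) : Finite {t : PlaneCactus // t.type = α} :=
  have ⟨_, hf⟩ := exists_planeCactus_bijective α
  have := finite_minimalFactorization (α.rank + 1) α
  .of_injective _ hf.1

section GeneratingFunction

open scoped MvPowerSeries.WithPiTopology

theorem nonarchimedeanRing_of_isLinearTopology (R : Type*) [Ring R] [TopologicalSpace R]
    [IsTopologicalRing R] [IsLinearTopology R R] : NonarchimedeanRing R where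
  is_nonarchimedean U hU := by
    obtain ⟨I, hI, hIU⟩ := (IsLinearTopology.hasBasis_open_submodule R).mem_iff.1 hU
    exact ⟨⟨I.toAddSubgroup, hI⟩, hIU⟩

theorem hasSum_monomial_of_finite_fibers {A σ R : Type*} [Semiring R] [TopologicalSpace R]
    (f : A → σ →₀ ℕ) (hf : ∀ α, Finite {a // f a = α}) :
    HasSum (fun a => MvPowerSeries.monomial (f a) (1 : R))
      (fun α => (Nat.card {a // f a = α} : R) : MvPowerSeries σ R) := by
  classical
  refine MvPowerSeries.WithPiTopology.hasSum_iff_hasSum_coeff.2 fun α => ?_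
  have hfin : {a | f a = α}.Finite := hf α
  have hcard : MvPowerSeries.coeff α (fun α => (Nat.card {a // f a = α} : R)) =
      ∑ a ∈ hfin.toFinset, MvPowerSeries.coeff α (MvPowerSeries.monomial (f a) (1 : R)) := by
    rw [Finset.sum_congr rfl fun a ha => by
      rw [← hfin.mem_toFinset.1 ha, MvPowerSeries.coeff_monomial_same]]
    rw [Finset.sum_const, nsmul_one, ← Set.ncard_eq_toFinset_card _ hfin]
    rfl
  rw [hcard]
  refine hasSum_sum_of_ne_finset_zero fun a ha => MvPowerSeries.coeff_monomial_ne ?_ _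
  exact fun h => ha (hfin.mem_toFinset.2 h.symm)

section Monomials

variable {σ R : Type*} [CommRing R] [UniformSpace R] [DiscreteUniformity R]

theorem hasSum_monomial_add {A B : Type*} {f : A → σ →₀ ℕ} {g : B → σ →₀ ℕ}
    {F G : MvPowerSeries σ R}
    (hf : HasSum (fun a => MvPowerSeries.monomial (f a) (1 : R)) F)
    (hg : HasSum (fun b => MvPowerSeries.monomial (g b) (1 : R)) G) :
    HasSum (fun x : A × B => MvPowerSeries.monomial (f x.1 + g x.2) (1 : R)) (F * G) := by
  have := nonarchimedeanRing_of_isLinearTopology (MvPowerSeries σ R)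
  simpa only [MvPowerSeries.monomial_mul_monomial, one_mul] using hf.mul_of_nonarchimedean hg

end Monomials

theorem hasSum_monomial_planeCactus :
    HasSum (fun t : PlaneCactus => MvPowerSeries.monomial t.type (1 : ℤ)) xi := by
  have hxi : xi = fun α => (Nat.card {t : PlaneCactus // t.type = α} : ℤ) :=
    funext fun α => congrArg _ (Htilde_eq_card α)
  exact hxi ▸ hasSum_monomial_of_finite_fibers _ PlaneCactus.finite_type_eq

/-- A chain along `k + 1` vertices is the pair of cacti at its first vertex, and a chain along the
other `k` vertices. -/
def CactusChain.succEquiv (k : ℕ) :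
    CactusChain (k + 1) ≃ (PlaneCactus × PlaneCactus) × CactusChain k where
  toFun | .cons p q c => ((p, q), c)
  invFun x := .cons x.1.1 x.1.2 x.2
  left_inv | .cons _ _ _ => rfl
  right_inv _ := rfl

theorem hasSum_monomial_cactusChain (k : ℕ) :
    HasSum (fun c : CactusChain k => MvPowerSeries.monomial c.type (1 : ℤ)) (xi ^ (2 * k)) := by
  induction k with
  | zero =>
    have hnil (c : CactusChain 0) (hc : c ≠ .nil) :
        MvPowerSeries.monomial c.type (1 : ℤ) = 0 := by cases c; exact absurd rfl hc
    exact hasSum_single CactusChain.nil hnil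
  | succ k ih =>
    have hT := hasSum_monomial_planeCactus
    rw [← (CactusChain.succEquiv k).symm.hasSum_iff, mul_add, pow_add, mul_comm, mul_one, sq]
    exact (hasSum_monomial_add (hasSum_monomial_add hT hT) ih :)

/-- A nontrivial plane cactus, as the number `k + 2` of vertices of the last polygon at its root,
the chain along this polygon, and the cactus of the other polygons at the root. -/
def PlaneCactus.ofSigma (x : Σ k, CactusChain (k + 1) × PlaneCactus) : PlaneCactus :=
  .attach x.2.1 x.2.2

theorem PlaneCactus.ofSigma_injective : Function.Injective ofSigma := by
  rintro ⟨k, c, t⟩ ⟨k', c', t'⟩ h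
  cases h
  rfl

theorem hasSum_monomial_ofSigma :
    HasSum (fun x => MvPowerSeries.monomial (PlaneCactus.ofSigma x).type (1 : ℤ)) (xi - 1) := by
  classical
  have h := hasSum_ite_sub_hasSum hasSum_monomial_planeCactus .point
  rw [← PlaneCactus.ofSigma_injective.hasSum_iff] at h
  · simpa [Function.comp_def, PlaneCactus.ofSigma, PlaneCactus.type] using h
  · rintro (_ | ⟨c, t⟩) ht
    · exact if_pos rfl
    · exact absurd ⟨⟨_, c, t⟩, rfl⟩ ht

/-- The enumeration `k ↦ k + 2` of the cycle lengths. -/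
def cycleLengthEquiv : ℕ ≃ CycleLength where
  toFun k := ⟨k + 2, Nat.le_add_left 2 k⟩
  invFun j := j - 2
  left_inv k := Nat.add_sub_cancel k 2
  right_inv j := Subtype.ext (Nat.sub_add_cancel j.2)

theorem hasSum_xi_nat :
    HasSum (fun k => MvPowerSeries.X (cycleLengthEquiv k) * xi ^ (2 * k + 3)) (xi - 1) := by
  refine hasSum_monomial_ofSigma.sigma fun k => ?_
  have h := hasSum_monomial_add (hasSum_monomial_cactusChain (k + 1)) hasSum_monomial_planeCactus
  have hmul := h.mul_left (MvPowerSeries.X (cycleLengthEquiv k))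
  simp only [MvPowerSeries.X, MvPowerSeries.monomial_mul_monomial, one_mul, ← pow_succ] at hmul
  exact hmul

theorem hasSum_xi :
    HasSum (fun j : CycleLength => MvPowerSeries.X j * xi ^ (2 * (j : ℕ) - 1)) (xi - 1) :=
  cycleLengthEquiv.hasSum_iff.1 hasSum_xi_nat

theorem eq_of_eq_one_add_X_mul_sq {R : Type*} [CommRing R] {f g : PowerSeries R}
    (hf : f = 1 + PowerSeries.X * f ^ 2) (hg : g = 1 + PowerSeries.X * g ^ 2) : f = g := by
  have hunit : IsUnit (1 - PowerSeries.X * (f + g)) :=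
    PowerSeries.isUnit_iff_constantCoeff.2 (by simp)
  refine sub_eq_zero.1 (hunit.mul_left_eq_zero.1 ?_)
  linear_combination hf - hg

/-- The power series `-(-t) ^ (j - 1) = (-1) ^ j t ^ (j - 1)` that is substituted for `x_j`, so
that `x ^ α` becomes `(-1) ^ |α| (-t) ^ ⟨α⟩`. -/
noncomputable def signedVar (j : CycleLength) : PowerSeries ℤ :=
  -(-PowerSeries.X) ^ ((j : ℕ) - 1)

theorem coeff_neg_one_pow_mul {R : Type*} [CommRing R] (m n : ℕ) (f : PowerSeries R) :
    PowerSeries.coeff n ((-1) ^ m * f) = (-1) ^ m * PowerSeries.coeff n f := by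
  have hC : ((-1) ^ m : PowerSeries R) = PowerSeries.C ((-1) ^ m) := by simp
  rw [hC, PowerSeries.coeff_C_mul]

theorem coeff_neg_X_pow {R : Type*} [CommRing R] (m n : ℕ) :
    PowerSeries.coeff n ((-PowerSeries.X) ^ m : PowerSeries R) = if n = m then (-1) ^ n else 0 := by
  rw [neg_pow, coeff_neg_one_pow_mul, PowerSeries.coeff_X_pow]
  split_ifs with h <;> simp [h]

theorem hasSubst_signedVar : MvPowerSeries.HasSubst signedVar where
  const_coeff j := by
    obtain ⟨k, rfl⟩ := cycleLengthEquiv.surjective j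
    have h : PowerSeries.constantCoeff (signedVar (cycleLengthEquiv k)) = 0 := by
      simp [signedVar, cycleLengthEquiv]
    exact h ▸ IsNilpotent.zero
  coeff_zero d := by
    have hd (j : CycleLength) (hj : MvPowerSeries.coeff d (signedVar j) ≠ 0) : d () = j - 1 := by
      rw [Finsupp.unique_single d] at hj
      have h : PowerSeries.coeff (d ()) (signedVar j) ≠ 0 := hj
      rw [signedVar, map_neg, coeff_neg_X_pow, neg_ne_zero, ite_ne_right_iff] at h
      exact h.1
    refine Set.Subsingleton.finite fun i hi j hj => Subtype.ext ?_
    have hij : (i : ℕ) - 1 = j - 1 := (hd i hi).symm.trans (hd j hj)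
    have := i.2
    have := j.2
    omega

theorem prod_signedVar_pow (α : CycleType) :
    (α.prod fun j a => signedVar j ^ a) = (-1) ^ α.size * (-PowerSeries.X) ^ α.rank := by
  simp only [signedVar, neg_pow (_ ^ _), ← pow_mul]
  rw [Finsupp.prod_mul, CycleType.size, CycleType.rank, Finsupp.sum, Finsupp.sum,
    ← Finset.prod_pow_eq_pow_sum, ← Finset.prod_pow_eq_pow_sum]
  rfl

theorem coeff_prod_signedVar_pow (n : ℕ) (α : CycleType) :
    PowerSeries.coeff n (α.prod fun j a => signedVar j ^ a) =
      if α.rank = n then (-1) ^ (α.size + n) else 0 := by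
  rw [prod_signedVar_pow, coeff_neg_one_pow_mul, coeff_neg_X_pow, mul_ite, ← pow_add, mul_zero]
  simp only [eq_comm]

theorem CycleType.finite_rank_eq (n : ℕ) : {α : CycleType | α.rank = n}.Finite := by
  refine (MvPowerSeries.coeff_subst_finite hasSubst_signedVar (R := ℤ) (fun _ => 1)
    (Finsupp.single () n)).subset fun α hα => ?_
  have h : PowerSeries.coeff n (α.prod fun j a => signedVar j ^ a) ≠ 0 := by
    simp only [coeff_prod_signedVar_pow, if_pos (show CycleType.rank α = n from hα)]
    exact pow_ne_zero _ (neg_ne_zero.2 one_ne_zero)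
  exact smul_ne_zero one_ne_zero h

theorem coeff_subst_signedVar (n : ℕ) (F : MvPowerSeries CycleLength ℤ) :
    PowerSeries.coeff n (F.subst signedVar) =
      ∑ᶠ (α : CycleType) (_ : α.rank = n), (-1) ^ (α.size + n) * MvPowerSeries.coeff α F := by
  refine (MvPowerSeries.coeff_subst hasSubst_signedVar F _).trans (finsum_congr fun α => ?_)
  have h := coeff_prod_signedVar_pow n α
  rw [PowerSeries.coeff] at h
  rw [h]
  split_ifs with hα <;> simp [hα, mul_comm]

theorem hasSum_subst_xi : HasSum
    (fun k => PowerSeries.X * xi.subst signedVar ^ 3 *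
      (-(PowerSeries.X * xi.subst signedVar ^ 2)) ^ k) (xi.subst signedVar - 1) := by
  let φ := MvPowerSeries.substAlgHom (R := ℤ) hasSubst_signedVar
  have hφ : ⇑φ = MvPowerSeries.subst signedVar := MvPowerSeries.coe_substAlgHom _
  have hterm (k : ℕ) : φ (MvPowerSeries.X (cycleLengthEquiv k) * xi ^ (2 * k + 3)) =
      PowerSeries.X * xi.subst signedVar ^ 3 * (-(PowerSeries.X * xi.subst signedVar ^ 2)) ^ k := by
    rw [map_mul, map_pow, MvPowerSeries.substAlgHom_X, hφ, signedVar,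
      show (cycleLengthEquiv k : ℕ) - 1 = k + 1 from rfl]
    ring
  have h := hasSum_xi_nat.map φ (hφ ▸ MvPowerSeries.continuous_subst hasSubst_signedVar)
  rwa [map_sub, map_one, (funext hterm : φ ∘ _ = _), hφ] at h

theorem subst_xi_eq :
    xi.subst signedVar = 1 + PowerSeries.X * xi.subst signedVar ^ 2 := by
  have hsum := hasSum_subst_xi
  set f : PowerSeries ℤ := xi.subst signedVar
  have hconst : MvPowerSeries.constantCoeff (-(PowerSeries.X * f ^ 2) : PowerSeries ℤ) = 0 :=
    (by simp : PowerSeries.constantCoeff (-(PowerSeries.X * f ^ 2)) = 0)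
  have hgeom := MvPowerSeries.WithPiTopology.one_sub_mul_tsum_pow_of_constantCoeff_eq_zero hconst
  have hsum' := (MvPowerSeries.WithPiTopology.summable_pow_of_constantCoeff_eq_zero
    hconst).hasSum.mul_left (PowerSeries.X * f ^ 3)
  have heq := hsum.unique hsum'
  set S := ∑' i, (-(PowerSeries.X * f ^ 2)) ^ i
  linear_combination (1 + PowerSeries.X * f ^ 2) * heq + PowerSeries.X * f ^ 3 * hgeom

theorem subst_xi_eq_catalanSeries :
    xi.subst signedVar = PowerSeries.map (Nat.castRingHom ℤ) PowerSeries.catalanSeries := by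
  refine eq_of_eq_one_add_X_mul_sq subst_xi_eq ?_
  conv_lhs => rw [← PowerSeries.catalanSeries_sq_mul_X_add_one]
  simp only [map_add, map_mul, map_pow, map_one, PowerSeries.map_X]
  ring

theorem finsum_signed_Htilde_eq_catalan (n : ℕ) :
    ∑ᶠ (α : CycleType) (_ : α.rank = n), (-1 : ℤ) ^ (α.size + n) * (Htilde α : ℤ) = catalan n := by
  have h := congrArg (PowerSeries.coeff n) subst_xi_eq_catalanSeries
  rw [coeff_subst_signedVar, PowerSeries.coeff_map, PowerSeries.catalanSeries_coeff] at h
  exact h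

end GeneratingFunction

theorem catalan_eq_one_div_mul_choose (n : ℕ) :
    (catalan n : ℚ) = 1 / ((n : ℚ) + 1) * ((2 * n).choose n : ℚ) := by
  rw [← Nat.centralBinom, ← succ_mul_catalan_eq_centralBinom]
  push_cast
  field_simp

open scoped MvPowerSeries.WithPiTopology in
theorem theorem2 :
    (Summable (fun j : CycleLength => MvPowerSeries.X j * xi ^ (2 * (j : ℕ) - 1)) ∧
      xi = 1 + ∑' j : CycleLength, MvPowerSeries.X j * xi ^ (2 * (j : ℕ) - 1)) ∧
    ∀ n : ℕ,
      {α : CycleType | α.rank = n}.Finite ∧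
      ((∑ᶠ (α : CycleType) (_ : α.rank = n), (-1 : ℤ) ^ (α.size + n) * (Htilde α : ℤ) : ℤ) : ℚ)
        = 1 / ((n : ℚ) + 1) * ((2 * n).choose n : ℚ) ∧
      (∑ᶠ (α : CycleType) (_ : α.rank = n), (-1 : ℤ) ^ (α.size + n) * (Htilde α : ℤ))
        = (catalan n : ℤ) := by
  refine ⟨⟨hasSum_xi.summable, ?_⟩, fun n => ⟨CycleType.finite_rank_eq n, ?_, ?_⟩⟩
  · rw [hasSum_xi.tsum_eq, add_sub_cancel]
  · rw [finsum_signed_Htilde_eq_catalan, Int.cast_natCast, catalan_eq_one_div_mul_choose]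
  · exact finsum_signed_Htilde_eq_catalan n
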